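/- Let $\kappa$ be an infinite regular cardinal; the case $\kappa = \infty$ is included by taking $\infty$ to be an inaccessible cardinal, "small" meaning of size $<\infty$. "$\kappa$-ary" means of size $<\kappa$. Definitions. A $\kappa$-Boolean algebra is a Boolean algebra with all $\kappa$-ary joins; homomorphisms are Boolean homomorphisms preserving $\kappa$-ary joins. The category $\kappa\mathbf{BorLoc}$ of $\kappa$-Borel locales and $\kappa$-Borel maps is the opposite of the category of $\kappa$-Boolean algebras; the algebra corresponding to a locale $X$ is denoted $\mathcal B_\kappa(X)$, and its elements are the $\kappa$-Borel sets of $X$. Each $B \in \mathcal B_\kappa(X)$ gives a sublocale of $X$, dual to the quotient $\mathcal B_\kappa(X) \to {\downarrow} B$, $C \mapsto B \wedge C$. A $\kappa$-Borel locale $X$ is standard if $\mathcal B_\kappa(X)$ has a presentation by fewer than $\kappa$ generators and fewer than $\kappa$ relations. A $\kappa$-Borel map $f : X \to Y$ is $\kappa$-ary-to-one (and $X$ is fiberwise $\kappa$-ary over $Y$) if $X$ has a $\kappa$-ary cover by $\kappa$-Borel sets to each of which the restriction of $f$ is a monomorphism. An analytic $\kappa$-Borel locale is the image, in $\kappa\mathbf{BorLoc}$,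 of a $\kappa$-Borel map between standard $\kappa$-Borel locales; these form a full subcategory $\kappa\Sigma^1_1\mathbf{BorLoc}$ of $\kappa\mathbf{BorLoc}$. A $\kappa$-analytic set of $Y$ is a subobject of $Y$ in $\kappa\Sigma^1_1\mathbf{BorLoc}$, and the $\kappa$-analytic image of a map is its image (the least subobject through which it factors) in $\kappa\Sigma^1_1\mathbf{BorLoc}$. Theorem. Let $Y$ be a standard $\kappa$-Borel locale. (1) Let $f : X \to Y$ be a $\kappa$-Borel map from a standard $\kappa$-Borel locale $X$. Then there are a nonempty directed poset $I$ with $|I| < \kappa$ and a diagram over $Y$ consisting of standard $\kappa$-Borel locales $X_i$ with $\kappa$-Borel maps $f_i : X_i \to Y$ ($i \in I$) and, functorially, $\kappa$-Borel maps $f_{ij} : X_i \to X_j$ with $f_j \circ f_{ij} = f_i$ for $i \ge j$, such that each $f_i$ is $\kappa$-ary-to-one and $X \cong \varprojlim_{i \in I} X_i$ over $Y$ (the limit being taken in $\kappa\mathbf{BorLoc}$). (2) Every $\kappa$-analytic set $A \subseteq Y$ is the $\kappa$-analytic image of a map $g : L \to Y$, with $L$ standard, which is a limit over $Y$ as in (1)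 of a $\kappa$-ary codirected diagram of fiberwise $\kappa$-ary standard $\kappa$-Borel locales over $Y$. -/

import Mathlib

open CategoryTheory Cardinal

universe u

namespace KappaBorel

/-- A `κ`-Boolean algebra: a Boolean algebra in which every subset of cardinality `< κ` has a
least upper bound. (Binary meets distribute over existing joins in every Boolean algebra.)

Throughout, `κ` ranges over the infinite regular cardinals of a universe `u`. The convention
`κ = ∞`, i.e. `∞` is an inaccessible cardinal, a small set is one of cardinality `< ∞`, and a
large algebra is one that need not be small, is the instance `κ = Cardinal.univ`. -/
structure KBool (κ : Cardinal.{u}) : Type (u + 1) where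
  carrier : Type u
  [str : BooleanAlgebra carrier]
  exists_isLUB : ∀ s : Set carrier, #s < κ → ∃ a, IsLUB s a

attribute [instance] KBool.str

variable {κ : Cardinal.{u}}

namespace KBool

/-- A homomorphism of `κ`-Boolean algebras: a homomorphism of bounded lattices (which
automatically preserves complements) that preserves joins of sets of cardinality `< κ`. -/
@[ext]
structure Hom (A B : KBool κ) where
  toLatticeHom : BoundedLatticeHom A.carrier B.carrier
  map_isLUB : ∀ s : Set A.carrier, #s < κ → ∀ a, IsLUB s a →
    IsLUB (toLatticeHom '' s) (toLatticeHom a)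

instance (A B : KBool κ) : CoeFun (Hom A B) (fun _ => A.carrier → B.carrier) where
  coe φ := φ.toLatticeHom

/-- The identity homomorphism. -/
def Hom.id (A : KBool κ) : Hom A A where
  toLatticeHom := BoundedLatticeHom.id A.carrier
  map_isLUB := by
    intro s _ a ha
    simpa using ha

/-- The composite `ψ ∘ φ`. -/
def Hom.comp {A B C : KBool κ} (φ : Hom A B) (ψ : Hom B C) : Hom A C where
  toLatticeHom := ψ.toLatticeHom.comp φ.toLatticeHom
  map_isLUB := by
    intro s hs a ha
    have h := ψ.map_isLUB _ (lt_of_le_of_lt mk_image_le hs) _ (φ.map_isLUB s hs a ha)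
    rw [Set.image_image] at h
    exact h

/-- The category `κBool`. -/
instance : Category (KBool κ) where
  Hom := Hom
  id := Hom.id
  comp := Hom.comp

/-- The join of a set of cardinality `< κ`. -/
noncomputable def sup (A : KBool κ) (s : Set A.carrier) (hs : #s < κ) : A.carrier :=
  (A.exists_isLUB s hs).choose

/-- The principal filterquotient `↓b` of a `κ`-Boolean algebra, with the order of `A`. -/
def below (A : KBool κ) (b : A.carrier) : KBool κ where
  carrier := Set.Iic b
  str :=
    letI : DistribLattice (Set.Iic b) := .ofInfSupLe
      (fun x y z => (inf_sup_left (x : A.carrier) y z).le)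
    { (inferInstance : DistribLattice (Set.Iic b)),
      (inferInstance : BoundedOrder (Set.Iic b)) with
      compl := fun x => ⟨b ⊓ (x : A.carrier)ᶜ, inf_le_left⟩
      inf_compl_le_bot := by
        rintro ⟨x, hx⟩
        change x ⊓ (b ⊓ xᶜ) ≤ ⊥
        rw [inf_left_comm, inf_compl_eq_bot, inf_bot_eq]
      top_le_sup_compl := by
        rintro ⟨x, hx⟩
        change b ≤ x ⊔ (b ⊓ xᶜ)
        rw [sup_inf_left, sup_compl_eq_top, inf_top_eq]
        exact le_sup_right }
  exists_isLUB := by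
    intro s hs
    obtain ⟨a, ha⟩ := A.exists_isLUB (Subtype.val '' s) (lt_of_le_of_lt mk_image_le hs)
    refine ⟨⟨a, ha.2 ?_⟩, ?_, ?_⟩
    · rintro _ ⟨x, _, rfl⟩
      exact x.2
    · intro x hx
      exact ha.1 ⟨x, hx, rfl⟩
    · intro y hy
      refine ha.2 ?_
      rintro _ ⟨x, hx, rfl⟩
      exact hy hx

/-- The quotient homomorphism `A → ↓b`, `a ↦ b ⊓ a`. -/
def toBelow (A : KBool κ) (b : A.carrier) : A ⟶ A.below b where
  toLatticeHom :=
    { toFun := fun a => ⟨b ⊓ a, inf_le_left⟩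
      map_sup' := fun x y => Subtype.ext (inf_sup_left b x y)
      map_inf' := fun x y => Subtype.ext (inf_inf_distrib_left b x y)
      map_top' := Subtype.ext (inf_top_eq b)
      map_bot' := Subtype.ext (inf_bot_eq b) }
  map_isLUB := by
    intro s _ a ha
    constructor
    · rintro _ ⟨x, hx, rfl⟩
      exact inf_le_inf_left b (ha.1 hx)
    · rintro ⟨y, hyb⟩ hy
      change b ⊓ a ≤ y
      rw [← le_himp_iff']
      refine ha.2 fun x hx => ?_
      rw [le_himp_iff']
      exact hy ⟨x, hx, rfl⟩

/-- Terms over a set `G` of generators in the signature of `κ`-Boolean algebras: complements, and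
joins of families of fewer than `κ` terms (indexed by a subset of a fixed set of size `κ`). -/
inductive Term (κ : Cardinal.{u}) (G : Type u) : Type u
  | gen (g : G) : Term κ G
  | compl (t : Term κ G) : Term κ G
  | sup (s : Set κ.out) (hs : #s < κ) (t : s → Term κ G) : Term κ G

/-- The value of a term in a `κ`-Boolean algebra under an assignment of the generators. -/
noncomputable def eval (A : KBool κ) {G : Type u} (γ : G → A.carrier) : Term κ G → A.carrier
  | .gen g => γ g
  | .compl t => (eval A γ t)ᶜ
  | .sup _ hs t => A.sup (Set.range fun i => eval A γ (t i)) (lt_of_le_of_lt mk_range_le hs)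

/-- The assignment `γ : G → A` exhibits `A` as the `κ`-Boolean algebra `⟨G | R⟩` presented by the
generators `G` and the relations `s = t` for `(s, t) ∈ R`: the relations hold in `A`, and `γ` is
universal among assignments in `κ`-Boolean algebras satisfying the relations. -/
def IsPresentation (A : KBool κ) {G : Type u} (R : Set (Term κ G × Term κ G))
    (γ : G → A.carrier) : Prop :=
  (∀ r ∈ R, A.eval γ r.1 = A.eval γ r.2) ∧
    ∀ (B : KBool κ) (δ : G → B.carrier), (∀ r ∈ R, B.eval δ r.1 = B.eval δ r.2) →
      ∃! φ : Hom A B, ∀ g, φ (γ g) = δ g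

/-- `A` is `κ`-presented: it has a presentation with fewer than `κ` generators and fewer than `κ`
relations. -/
def IsKPresented (A : KBool κ) : Prop :=
  ∃ (G : Type u) (R : Set (Term κ G × Term κ G)) (γ : G → A.carrier),
    #G < κ ∧ #R < κ ∧ A.IsPresentation R γ

end KBool

/-- The category of `κ`-Borel locales and `κ`-Borel maps, the opposite of the category of
`κ`-Boolean algebras. The `κ`-Borel sets of `X` are the elements of the algebra `X.unop`, and
`f.unop` is the preimage homomorphism `f^*`. -/
abbrev KBorLoc (κ : Cardinal.{u}) : Type (u + 1) := (KBool κ)ᵒᵖ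

/-- The set (algebra) of `κ`-Borel sets of a `κ`-Borel locale. -/
abbrev KBorLoc.Borel (X : KBorLoc κ) : Type u := X.unop.carrier

/-- A `κ`-Borel locale is standard if its algebra of `κ`-Borel sets is `κ`-presented. -/
def IsStandard (X : KBorLoc κ) : Prop := X.unop.IsKPresented

/-- The `κ`-Borel sublocale of `X` given by a `κ`-Borel set `B` of `X`. -/
def sublocale (X : KBorLoc κ) (B : X.Borel) : KBorLoc κ := Opposite.op (X.unop.below B)

/-- The inclusion of the sublocale given by a `κ`-Borel set; its preimage map is `B ⊓ (-)`. -/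
def inclusion (X : KBorLoc κ) (B : X.Borel) : sublocale X B ⟶ X := (X.unop.toBelow B).op

/-- `f : X ⟶ Y` is `κ`-ary-to-one (`X` is fiberwise `κ`-ary over `Y`): `X` is covered by fewer
than `κ` many `κ`-Borel sets to each of which the restriction of `f` is a monomorphism. -/
def IsKaryToOne {X Y : KBorLoc κ} (f : X ⟶ Y) : Prop :=
  ∃ S : Set X.Borel, #S < κ ∧ IsLUB S ⊤ ∧ ∀ B ∈ S, Mono (inclusion X B ≫ f)

/-- A subobject `A` of `Y` is the image of `f : X ⟶ Y` in the category `C` if it is the least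
subobject of `Y` through which `f` factors. -/
def IsImageOf {C : Type*} [Category C] {X Y : C} (A : Subobject Y) (f : X ⟶ Y) : Prop :=
  IsLeast {S : Subobject Y | S.Factors f} A

/-- An analytic `κ`-Borel locale is a `κ`-Borel locale `X` which is (the domain of) the image, in
the category of all `κ`-Borel locales, of a `κ`-Borel map between standard ones. -/
def IsAnalytic : ObjectProperty (KBorLoc κ) := fun X =>
  ∃ (P Q : KBorLoc κ) (p : P ⟶ Q) (m : X ⟶ Q) (_ : Mono m),
    IsStandard P ∧ IsStandard Q ∧ IsImageOf (Subobject.mk m) p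

/-- The category of analytic `κ`-Borel locales, a full subcategory of `KBorLoc κ`. -/
abbrev KAnLoc (κ : Cardinal.{u}) : Type (u + 1) := (IsAnalytic (κ := κ)).FullSubcategory

theorem IsStandard.isAnalytic {X : KBorLoc κ} (hX : IsStandard X) : IsAnalytic X := by
  refine ⟨X, X, 𝟙 X, 𝟙 X, inferInstance, hX, hX, ?_, ?_⟩
  · exact (Subobject.mk_factors_iff _ _).2 ⟨𝟙 X, by simp [MonoOver.arrow]⟩
  · intro S hS
    exact Subobject.mk_le_of_comm (S.factorThru (𝟙 X) hS) (S.factorThru_arrow _ hS)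

/-- A standard `κ`-Borel locale, regarded as an analytic one. -/
def KAnLoc.ofStandard (X : KBorLoc κ) (hX : IsStandard X) : KAnLoc κ := ⟨X, hX.isAnalytic⟩

/-- A `κ`-analytic set of a standard `κ`-Borel locale `Y`: a subobject of `Y` in the category of
analytic `κ`-Borel locales. -/
abbrev KAnalyticSet (Y : KBorLoc κ) (hY : IsStandard Y) := Subobject (KAnLoc.ofStandard Y hY)

/-- `A` is the `κ`-analytic image of the `κ`-Borel map `f`, i.e. its image in the category of
analytic `κ`-Borel locales. -/
def IsKAnalyticImage {X Y : KBorLoc κ} (hX : IsStandard X) (hY : IsStandard Y)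
    (A : KAnalyticSet Y hY) (f : X ⟶ Y) : Prop :=
  IsImageOf A (ObjectProperty.homMk f : KAnLoc.ofStandard X hX ⟶ KAnLoc.ofStandard Y hY)

/-- `f : X ⟶ Y` is, over `Y`, the limit of a `κ`-ary codirected diagram of fiberwise `κ`-ary
standard `κ`-Borel locales over `Y`: there are a nonempty directed poset `I` of cardinality `< κ`,
standard `κ`-Borel locales `X i` with `κ`-ary-to-one maps `X i ⟶ Y`, and, functorially,
maps `X i ⟶ X j` over `Y` for `j ≤ i`, such that `X` is isomorphic over `Y` to the limit of
this diagram. -/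
def IsCodirectedLimitOfFiberwiseKary {X Y : KBorLoc κ} (f : X ⟶ Y) : Prop :=
  ∃ (I : Type u) (_ : PartialOrder I) (D : Iᵒᵖ ⥤ Over Y),
    Nonempty I ∧ IsDirectedOrder I ∧ #I < κ ∧
    (∀ i, IsStandard (D.obj i).left ∧ IsKaryToOne (D.obj i).hom) ∧
    ∃ c : Limits.Cone D, Nonempty (Limits.IsLimit c) ∧ Nonempty (Over.mk f ≅ c.pt)

end KappaBorel

namespace KappaBorel

variable {κ : Cardinal.{u}}

/-! ### Homomorphisms, products, subalgebras and images of `κ`-Boolean algebras -/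

namespace KBool

/-! For (1), write `B` and `A` for the algebras of `Y` and `X`. Present `A` with generators that
include those of `B`, and let `U` be a subterm-closed set of fewer than `κ` terms containing all
generators and both sides of all relations. Heuristically, a point of `X` over a point of `Y` is a
truth assignment on `U` that respects complements, joins and relations. That a true join has a true
member is a condition on infinitely many terms at once. If the value of a true join also records a
witness, namely its first true member, then every condition involves at most two terms; taking the
first one makes the witness unique. Hence `A` classifies, over `B`, families of partitions indexed
by `U` subject to pairwise constraints (`IsModel`): `IsModel.eval_eq` and `IsModel.unique` recover
the terms from a model, and `isModel_witnessRegion` gives the universal model.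

Keeping only a finite set `F` of terms yields the disjoint union, over the fewer than `κ` value
assignments on `F`, of the Borel sets of `Y` where the assignment is allowed. This is standard
(`IsKPresented.fib`) and fiberwise `κ`-ary (`isKaryToOne_fib`). Since constraints are pairwise, a
compatible family of models on the finite subsets of `U` is a model on `U`; so `X` is the limit of
these stages over the directed poset of finite subsets of `U`.

For (2), by (1) it suffices to exhibit `A ⊆ Y` as the analytic image of some standard `P`. An
analytic locale receives a map from a standard one with injective preimage map
(`IsAnalytic.exists_cover`). For the composite `P ⟶ A ⟶ Y` to have image `A`, every analytic
subobject through which it factors must contain `A`; this follows once monomorphisms into `Y` are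
dual to surjections. That rests on strong amalgamation (`exists_separation`): an element outside the
image of a homomorphism is separated by two homomorphisms agreeing on the image. Among analytic
locales the test object must itself be analytic, so the separation is carried out in a `κ`-presented
pushout. -/

theorem isLUB_sup (A : KBool κ) (s : Set A.carrier) (hs : #s < κ) : IsLUB s (A.sup s hs) :=
  (A.exists_isLUB s hs).choose_spec

theorem exists_isLUB_range (A : KBool κ) {ι : Type u} (hι : #ι < κ) (f : ι → A.carrier) :
    ∃ a, IsLUB (Set.range f) a :=
  A.exists_isLUB _ (mk_range_le.trans_lt hι)

theorem Hom.ext_apply {A B : KBool κ} {φ ψ : Hom A B} (h : ∀ x, φ x = ψ x) : φ = ψ :=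
  Hom.ext (DFunLike.ext _ _ h)

theorem Hom.map_isLUB_range {A B : KBool κ} (φ : Hom A B) {ι : Type u} (hι : #ι < κ)
    {f : ι → A.carrier} {a : A.carrier} (h : IsLUB (Set.range f) a) :
    IsLUB (Set.range fun i => φ (f i)) (φ a) := by
  have := φ.map_isLUB _ (mk_range_le.trans_lt hι) _ h
  rwa [← Set.range_comp] at this

theorem Hom.map_compl {A B : KBool κ} (φ : Hom A B) (a : A.carrier) : φ aᶜ = (φ a)ᶜ :=
  map_compl' φ.toLatticeHom a

theorem Hom.mono {A B : KBool κ} (φ : Hom A B) {a b : A.carrier} (h : a ≤ b) : φ a ≤ φ b :=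
  OrderHomClass.mono φ.toLatticeHom h

/-- A map preserving complements and joins of fewer than `κ` elements is a homomorphism. -/
def Hom.ofCompl (hκ : ℵ₀ ≤ κ) {A B : KBool κ} (f : A.carrier → B.carrier)
    (hc : ∀ a, f aᶜ = (f a)ᶜ)
    (hs : ∀ s : Set A.carrier, #s < κ → ∀ a, IsLUB s a → IsLUB (f '' s) (f a)) : Hom A B :=
  have hbot : f ⊥ = ⊥ := by
    have := hs ∅ (by simpa using aleph0_pos.trans_le hκ) ⊥ (by simp)
    simpa using this
  have hsup (a b : A.carrier) : f (a ⊔ b) = f a ⊔ f b := by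
    have := hs {a, b} ((lt_aleph0_iff_set_finite.2 (Set.toFinite _)).trans_le hκ) _ isLUB_pair
    rw [Set.image_pair] at this
    exact this.unique isLUB_pair
  { toLatticeHom :=
      { toFun := f
        map_sup' := hsup
        map_inf' := fun a b => by
          rw [← compl_compl (a ⊓ b), compl_inf, hc, hsup, hc, hc, ← compl_inf, compl_compl]
        map_top' := by rw [← compl_bot, hc, hbot, compl_bot]
        map_bot' := hbot }
    map_isLUB := hs }

/-- The product of a family of `κ`-Boolean algebras. -/
def pi {S : Type u} (B : S → KBool κ) : KBool κ where
  carrier := ∀ s, (B s).carrier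
  exists_isLUB := by
    intro X hX
    choose a ha using fun s => (B s).exists_isLUB (Function.eval s '' X) (mk_image_le.trans_lt hX)
    exact ⟨a, isLUB_pi.2 ha⟩

/-- The sub-`κ`-Boolean algebra on a set closed under complements and joins of fewer than `κ`
elements. -/
def sub (hκ : ℵ₀ ≤ κ) (A : KBool κ) (U : Set A.carrier) (hc : ∀ x ∈ U, xᶜ ∈ U)
    (hs : ∀ s ⊆ U, #s < κ → ∀ a, IsLUB s a → a ∈ U) : KBool κ :=
  have hsup {a b : A.carrier} (ha : a ∈ U) (hb : b ∈ U) : a ⊔ b ∈ U :=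
    hs {a, b} (Set.pair_subset ha hb)
      ((lt_aleph0_iff_set_finite.2 (Set.toFinite _)).trans_le hκ) _ isLUB_pair
  let L : BooleanSubalgebra A.carrier :=
    { carrier := U
      supClosed' := fun _ ha _ hb => hsup ha hb
      infClosed' := fun a ha b hb => by
        rw [← compl_compl (a ⊓ b), compl_inf]
        exact hc _ (hsup (hc _ ha) (hc _ hb))
      compl_mem' := fun ha => hc _ ha
      bot_mem' := hs ∅ (Set.empty_subset _) (by simpa using aleph0_pos.trans_le hκ) ⊥ (by simp) }
  { carrier := L
    exists_isLUB := by
      intro s hsκ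
      obtain ⟨a, ha⟩ := A.exists_isLUB (Subtype.val '' s) (mk_image_le.trans_lt hsκ)
      refine ⟨⟨a, hs (Subtype.val '' s) ?_ (mk_image_le.trans_lt hsκ) a ha⟩, ?_, ?_⟩
      · rintro _ ⟨x, -, rfl⟩
        exact x.2
      · intro x hx
        exact ha.1 ⟨x, hx, rfl⟩
      · intro y hy
        refine ha.2 ?_
        rintro _ ⟨x, hx, rfl⟩
        exact hy hx }

/-- The inclusion of a sub-`κ`-Boolean algebra. -/
def subHom (hκ : ℵ₀ ≤ κ) (A : KBool κ) (U : Set A.carrier) (hc : ∀ x ∈ U, xᶜ ∈ U)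
    (hs : ∀ s ⊆ U, #s < κ → ∀ a, IsLUB s a → a ∈ U) : Hom (A.sub hκ U hc hs) A :=
  .ofCompl hκ Subtype.val (fun _ => rfl) (by
    intro s hsκ a ha
    obtain ⟨a', ha'⟩ := A.exists_isLUB (Subtype.val '' s) (mk_image_le.trans_lt hsκ)
    have hmem : a' ∈ U := hs (Subtype.val '' s) (by rintro _ ⟨x, -, rfl⟩; exact x.2)
      (mk_image_le.trans_lt hsκ) a' ha'
    have : IsLUB s (⟨a', hmem⟩ : (A.sub hκ U hc hs).carrier) := by
      refine ⟨fun x hx => ha'.1 ⟨x, hx, rfl⟩, fun y hy => ha'.2 ?_⟩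
      rintro _ ⟨x, hx, rfl⟩
      exact hy hx
    rw [ha.unique this]
    exact ha')

/-- A homomorphism factors through a surjective one if it identifies at least as much. -/
theorem Hom.exists_factor (hκ : ℵ₀ ≤ κ) {A S C : KBool κ} (σ : Hom A S)
    (hσ : Function.Surjective σ) (ψ : Hom A C) (h : ∀ x y, σ x = σ y → ψ x = ψ y) :
    ∃ θ : Hom S C, ∀ x, θ (σ x) = ψ x := by
  obtain ⟨r, hr⟩ := hσ.hasRightInverse
  refine ⟨.ofCompl hκ (fun z => ψ (r z)) ?_ ?_, fun x => h _ _ (hr _)⟩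
  · intro z
    rw [← ψ.map_compl]
    apply h
    rw [hr, σ.map_compl, hr]
  · intro s hs a ha
    obtain ⟨a', ha'⟩ := A.exists_isLUB (r '' s) (mk_image_le.trans_lt hs)
    have h1 := σ.map_isLUB _ (mk_image_le.trans_lt hs) _ ha'
    have h2 := ψ.map_isLUB _ (mk_image_le.trans_lt hs) _ ha'
    rw [Set.image_image] at h1 h2
    simp only [hr _, Set.image_id'] at h1
    have : ψ (r a) = ψ a' := h _ _ (by rw [hr, ha.unique h1])
    change IsLUB _ (ψ (r a))
    rw [this]
    exact h2

/-- The image of a homomorphism, as a sub-`κ`-Boolean algebra. -/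
theorem Hom.exists_image (hκ : ℵ₀ ≤ κ) {A B : KBool κ} (φ : Hom A B) :
    ∃ (M : KBool κ) (q : Hom A M) (j : Hom M B),
      Function.Surjective q ∧ Function.Injective j ∧ ∀ x, j (q x) = φ x := by
  have hc : ∀ x ∈ Set.range φ, xᶜ ∈ Set.range φ := by
    rintro _ ⟨x, rfl⟩
    exact ⟨xᶜ, φ.map_compl x⟩
  have hs : ∀ s ⊆ Set.range φ, #s < κ → ∀ a, IsLUB s a → a ∈ Set.range φ := by
    intro s hsub hs a ha
    choose! r hr using hsub
    obtain ⟨a', ha'⟩ := A.exists_isLUB (r '' s) (mk_image_le.trans_lt hs)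
    have h1 := φ.map_isLUB _ (mk_image_le.trans_lt hs) _ ha'
    rw [Set.image_image, Set.image_congr (fun x hx => hr hx), Set.image_id'] at h1
    exact ⟨a', h1.unique ha⟩
  let j := B.subHom hκ _ hc hs
  refine ⟨B.sub hκ _ hc hs, .ofCompl hκ (fun x => ⟨φ x, x, rfl⟩) ?_ ?_, j, ?_, ?_, fun x => rfl⟩
  · intro a
    exact Subtype.ext (φ.map_compl a)
  · intro s hsκ a ha
    have h := φ.map_isLUB s hsκ a ha
    constructor
    · rintro _ ⟨x, hx, rfl⟩
      exact h.1 ⟨x, hx, rfl⟩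
    · intro y hy
      refine h.2 ?_
      rintro _ ⟨x, hx, rfl⟩
      exact hy ⟨x, hx, rfl⟩
  · rintro ⟨_, x, rfl⟩
    exact ⟨x, rfl⟩
  · exact Subtype.val_injective

/-! ### Terms -/

theorem isLUB_eval_sup (A : KBool κ) {G : Type u} (γ : G → A.carrier) (s : Set κ.out)
    (hs : #s < κ) (t : s → Term κ G) :
    IsLUB (Set.range fun i => A.eval γ (t i)) (A.eval γ (.sup s hs t)) := by
  rw [eval]
  exact A.isLUB_sup _ _

theorem Hom.map_eval {A B : KBool κ} (φ : Hom A B) {G : Type u} (γ : G → A.carrier)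
    (t : Term κ G) : φ (A.eval γ t) = B.eval (fun g => φ (γ g)) t := by
  induction t with
  | gen g => rfl
  | compl t ih => rw [eval, eval, φ.map_compl, ih]
  | sup s hs t ih =>
    have h := φ.map_isLUB_range hs (A.isLUB_eval_sup γ s hs t)
    simp only [ih] at h
    exact h.unique (B.isLUB_eval_sup _ s hs t)

/-- Renaming of the generators in a term. -/
def Term.map {G H : Type u} (f : G → H) : Term κ G → Term κ H
  | .gen g => .gen (f g)
  | .compl t => .compl (t.map f)
  | .sup s hs t => .sup s hs fun i => (t i).map f

theorem eval_map (A : KBool κ) {G H : Type u} (f : G → H) (γ : H → A.carrier) (t : Term κ G) :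
    A.eval γ (t.map f) = A.eval (fun g => γ (f g)) t := by
  induction t with
  | gen g => rfl
  | compl t ih => rw [Term.map, eval, eval, ih]
  | sup s hs t ih =>
    have h := A.isLUB_eval_sup γ s hs (fun i => (t i).map f)
    simp only [ih] at h
    exact h.unique (A.isLUB_eval_sup _ s hs t)

/-- The join of a family of fewer than `κ` terms, indexed by an arbitrary type. -/
theorem Term.exists_iSup {G ι : Type u} (hι : #ι < κ) (t : ι → Term κ G) :
    ∃ t' : Term κ G, ∀ (A : KBool κ) (γ : G → A.carrier),
      IsLUB (Set.range fun i => A.eval γ (t i)) (A.eval γ t') := by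
  have : #ι ≤ #κ.out := by rw [mk_out]; exact hι.le
  obtain ⟨e⟩ := this
  -- Joins of terms are indexed by subsets of `κ.out`, so `ι` is replaced by its image under an
  -- embedding.
  refine ⟨.sup (Set.range e) (mk_range_le.trans_lt hι)
    (fun x => t ((Equiv.ofInjective e e.injective).symm x)), fun A γ => ?_⟩
  have h := A.isLUB_eval_sup γ (Set.range e) (mk_range_le.trans_lt hι)
    (fun x => t ((Equiv.ofInjective e e.injective).symm x))
  have h2 := (Equiv.ofInjective e e.injective).symm.surjective.range_comp
    (fun i => A.eval γ (t i))
  rw [← h2]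
  exact h

/-- The join of a family of fewer than `κ` terms. -/
noncomputable def Term.iSup {G ι : Type u} (hι : #ι < κ) (t : ι → Term κ G) : Term κ G :=
  (Term.exists_iSup hι t).choose

theorem isLUB_eval_iSup (A : KBool κ) {G ι : Type u} (γ : G → A.carrier) (hι : #ι < κ)
    (t : ι → Term κ G) :
    IsLUB (Set.range fun i => A.eval γ (t i)) (A.eval γ (Term.iSup hι t)) :=
  (Term.exists_iSup hι t).choose_spec A γ

theorem mk_lt_of_finite (hκ : ℵ₀ ≤ κ) (ι : Type u) [Finite ι] : #ι < κ :=
  (lt_aleph0_of_finite ι).trans_le hκ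

/-- The bottom element, as a term. -/
noncomputable def Term.bot (hκ : ℵ₀ ≤ κ) {G : Type u} : Term κ G :=
  Term.iSup (ι := PEmpty) (mk_lt_of_finite hκ _) PEmpty.elim

/-- Binary meets of terms. -/
noncomputable def Term.inf (hκ : ℵ₀ ≤ κ) {G : Type u} (s t : Term κ G) : Term κ G :=
  .compl (Term.iSup (ι := ULift Bool) (mk_lt_of_finite hκ _)
    fun i => if i.down then .compl s else .compl t)

theorem eval_bot (hκ : ℵ₀ ≤ κ) (A : KBool κ) {G : Type u} (γ : G → A.carrier) :
    A.eval γ (Term.bot hκ) = ⊥ :=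
  (A.isLUB_eval_iSup γ _ _).unique (by simp [Set.range_eq_empty])

theorem eval_inf (hκ : ℵ₀ ≤ κ) (A : KBool κ) {G : Type u} (γ : G → A.carrier) (s t : Term κ G) :
    A.eval γ (s.inf hκ t) = A.eval γ s ⊓ A.eval γ t := by
  have h := A.isLUB_eval_iSup γ (mk_lt_of_finite hκ (ULift.{u} Bool))
    fun i => if i.down then .compl s else .compl t
  have h2 : A.eval γ (Term.iSup (ι := ULift Bool) (mk_lt_of_finite hκ _)
    fun i => if i.down then .compl s else .compl t) = (A.eval γ s)ᶜ ⊔ (A.eval γ t)ᶜ := by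
    refine h.unique ⟨?_, fun y hy => sup_le (hy ⟨⟨true⟩, rfl⟩) (hy ⟨⟨false⟩, rfl⟩)⟩
    rintro _ ⟨⟨_ | _⟩, rfl⟩
    · exact le_sup_right
    · exact le_sup_left
  rw [Term.inf, eval, h2, ← compl_inf, compl_compl]

theorem eval_range_compl (A : KBool κ) {G : Type u} (γ : G → A.carrier) :
    ∀ x ∈ Set.range (A.eval γ), xᶜ ∈ Set.range (A.eval γ) := by
  rintro _ ⟨t, rfl⟩
  exact ⟨.compl t, rfl⟩

theorem eval_range_isLUB (A : KBool κ) {G : Type u} (γ : G → A.carrier) :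
    ∀ s ⊆ Set.range (A.eval γ), #s < κ → ∀ a, IsLUB s a → a ∈ Set.range (A.eval γ) := by
  intro s hsub hs a ha
  choose r hr using fun x : s => hsub x.2
  refine ⟨Term.iSup hs r, (A.isLUB_eval_iSup γ hs r).unique ?_⟩
  simpa only [hr, Subtype.range_coe] using ha

/-- A presented algebra is generated by its generators. -/
theorem IsPresentation.eval_surjective (hκ : ℵ₀ ≤ κ) {A : KBool κ} {G : Type u}
    {R : Set (Term κ G × Term κ G)} {γ : G → A.carrier} (h : A.IsPresentation R γ) :
    Function.Surjective (A.eval γ) := by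
  let j := A.subHom hκ (Set.range (A.eval γ)) (A.eval_range_compl γ) (A.eval_range_isLUB γ)
  let δ : G → (A.sub hκ (Set.range (A.eval γ)) (A.eval_range_compl γ)
    (A.eval_range_isLUB γ)).carrier := fun g => ⟨γ g, .gen g, rfl⟩
  have hj : ∀ t, (eval _ δ t).1 = A.eval γ t := fun t => j.map_eval δ t
  obtain ⟨φ, hφ, -⟩ := h.2 _ δ fun r hr => Subtype.ext (by rw [hj, hj]; exact h.1 r hr)
  -- By uniqueness the identity of `A` factors through the subalgebra of values of terms, which is
  -- therefore all of `A`.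
  have := (h.2 A γ h.1).unique (y₁ := φ.comp j) (y₂ := Hom.id A)
    (fun g => congrArg Subtype.val (hφ g)) (fun g => rfl)
  intro x
  obtain ⟨t, ht⟩ := (φ x).2
  exact ⟨t, ht.trans (congrArg (fun f : Hom A A => f x) this)⟩

theorem IsPresentation.hom_ext {A B : KBool κ} {G : Type u}
    {R : Set (Term κ G × Term κ G)} {γ : G → A.carrier} (h : A.IsPresentation R γ)
    {φ ψ : Hom A B} (H : ∀ g, φ (γ g) = ψ (γ g)) : φ = ψ := by
  refine (h.2 B (fun g => ψ (γ g)) fun r hr => ?_).unique H fun _ => rfl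
  rw [← ψ.map_eval, ← ψ.map_eval, h.1 r hr]

/-! ### Partitions -/

/-- A family of pairwise disjoint elements with join `⊤`. -/
structure IsPartition {C : KBool κ} {S : Type u} (e : S → C.carrier) : Prop where
  disjoint : ∀ s s', s ≠ s' → e s ⊓ e s' = ⊥
  isLUB : IsLUB (Set.range e) ⊤

/-- `x ⇨ y` lies above every piece, hence above their join `⊤`. Thus inequalities may be checked
piece by piece. -/
theorem IsPartition.le {C : KBool κ} {S : Type u} {e : S → C.carrier} (he : IsPartition e)
    {x y : C.carrier} (h : ∀ s, x ⊓ e s ≤ y) : x ≤ y := by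
  have : ⊤ ≤ x ⇨ y := he.isLUB.2 (by
    rintro _ ⟨s, rfl⟩
    rw [le_himp_iff, inf_comm]
    exact h s)
  simpa using this

theorem IsPartition.ext {C : KBool κ} {S : Type u} {e : S → C.carrier} (he : IsPartition e)
    {x y : C.carrier} (h : ∀ s, x ⊓ e s = y ⊓ e s) : x = y :=
  le_antisymm (he.le fun s => (h s).trans_le inf_le_left)
    (he.le fun s => (h s).symm.trans_le inf_le_left)

theorem IsPartition.map {C D : KBool κ} {S : Type u} (hS : #S < κ) {e : S → C.carrier}
    (he : IsPartition e) (φ : Hom C D) : IsPartition fun s => φ (e s) where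
  disjoint s s' h := by
    rw [← map_inf φ.toLatticeHom, he.disjoint s s' h]
    exact map_bot φ.toLatticeHom
  isLUB := by
    have := φ.map_isLUB_range hS he.isLUB
    rwa [map_top φ.toLatticeHom] at this

theorem IsPartition.finset_inf {C : KBool κ} {ι : Type u} [Fintype ι] {V : ι → Type u}
    [∀ i, Nonempty (V i)] {e : ∀ i, V i → C.carrier} (he : ∀ i, IsPartition (e i)) :
    IsPartition fun s : ∀ i, V i => Finset.univ.inf fun i => e i (s i) where
  disjoint s s' h := by
    obtain ⟨i, hi⟩ := Function.ne_iff.1 h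
    rw [eq_bot_iff, ← (he i).disjoint _ _ hi]
    exact inf_le_inf (Finset.inf_le (Finset.mem_univ i)) (Finset.inf_le (Finset.mem_univ i))
  isLUB := by
    classical
    refine ⟨fun _ _ => le_top, fun y hy => ?_⟩
    have key : ∀ G : Finset ι, (∀ s : ∀ i, V i, (G.inf fun i => e i (s i)) ≤ y) → ⊤ ≤ y := by
      intro G
      induction G using Finset.induction_on with
      | empty => exact fun h => h fun i => Classical.arbitrary _
      | insert i G hi ih =>
        -- Letting `v` run through the partition `e i` removes the coordinate `i` from the meet.
        refine fun h => ih fun s => (he i).le fun v => ?_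
        have h1 := h (Function.update s i v)
        rw [Finset.inf_insert, Function.update_self, inf_comm] at h1
        refine le_trans (inf_le_inf_right _ (le_of_eq ?_)) h1
        refine Finset.inf_congr rfl fun j hj => ?_
        rw [Function.update_of_ne (ne_of_mem_of_not_mem hj hi)]
    exact key Finset.univ fun s => hy ⟨s, rfl⟩

/-! ### Disjoint unions of Borel sets of the base -/

/-- The product of the algebras `↓(b s)`, dual to the disjoint union of the `b s`. -/
def fib (B : KBool κ) {S : Type u} (b : S → B.carrier) : KBool κ :=
  (pi fun _ : S => B).below b

/-- The diagonal homomorphism, dual to the projection of the disjoint union. -/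
def fibBase (B : KBool κ) {S : Type u} (b : S → B.carrier) : Hom B (B.fib b) :=
  Hom.comp (B := pi fun _ : S => B)
    { toLatticeHom :=
        { toFun := fun x _ => x
          map_sup' := fun _ _ => rfl
          map_inf' := fun _ _ => rfl
          map_top' := rfl
          map_bot' := rfl }
      map_isLUB := by
        intro s _ a ha
        refine ⟨?_, fun y hy i => ha.2 fun x hx => hy ⟨x, hx, rfl⟩ i⟩
        rintro _ ⟨x, hx, rfl⟩ i
        exact ha.1 hx }
    ((pi fun _ : S => B).toBelow b)

theorem fibBase_apply (B : KBool κ) {S : Type u} (b : S → B.carrier) (x : B.carrier) (s : S) :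
    (B.fibBase b x).1 s = b s ⊓ x := rfl

open Classical in
/-- The union of the components with index satisfying `p`. -/
noncomputable def block (B : KBool κ) {S : Type u} (b : S → B.carrier) (p : S → Prop) :
    (B.fib b).carrier :=
  ⟨fun s => if p s then b s else ⊥, fun s => by
    dsimp only
    split_ifs
    exacts [le_rfl, bot_le]⟩

open Classical in
theorem block_apply (B : KBool κ) {S : Type u} (b : S → B.carrier) (p : S → Prop) (s : S) :
    (B.block b p).1 s = if p s then b s else ⊥ := rfl

theorem fib_le_iff {B : KBool κ} {S : Type u} {b : S → B.carrier} {x y : (B.fib b).carrier} :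
    x ≤ y ↔ ∀ s, x.1 s ≤ y.1 s := Iff.rfl

theorem fib_inf_apply {B : KBool κ} {S : Type u} {b : S → B.carrier} (x y : (B.fib b).carrier)
    (s : S) : (x ⊓ y).1 s = x.1 s ⊓ y.1 s := rfl

theorem fib_le {B : KBool κ} {S : Type u} {b : S → B.carrier} (x : (B.fib b).carrier)
    (s : S) : x.1 s ≤ b s := x.2 s

theorem isPartition_block (B : KBool κ) {S W : Type u} (b : S → B.carrier) (f : S → W) :
    IsPartition fun w => B.block b fun s => f s = w where
  disjoint w w' h := by
    rw [eq_bot_iff, fib_le_iff]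
    intro s
    rw [fib_inf_apply, block_apply, block_apply]
    split_ifs with h1 h2
    · exact absurd (h1.symm.trans h2) h
    · exact inf_le_right
    · exact inf_le_left
    · exact inf_le_left
  isLUB := by
    refine ⟨fun _ _ => le_top, fun y hy => ?_⟩
    rw [fib_le_iff]
    intro s
    have := fib_le_iff.1 (hy ⟨f s, rfl⟩) s
    rw [block_apply, if_pos rfl] at this
    exact (fib_le _ s).trans this

/-- Joins are componentwise: replacing the component `s` of the top element by the join of the
`s`-components of `X` gives an upper bound of `X`, hence an element above `a`. -/
theorem isLUB_fib {B : KBool κ} {S : Type u} {b : S → B.carrier} {X : Set (B.fib b).carrier}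
    {a : (B.fib b).carrier} (h : IsLUB X a) (hX : #X < κ) (s : S) :
    IsLUB ((fun x => x.1 s) '' X) (a.1 s) := by
  classical
  obtain ⟨c, hc⟩ := B.exists_isLUB ((fun x : (B.fib b).carrier => x.1 s) '' X)
    (mk_image_le.trans_lt hX)
  have hcb : c ≤ b s := hc.2 (by rintro _ ⟨x, -, rfl⟩; exact fib_le x s)
  have hle : a ≤ ⟨fun s' => if s' = s then c else b s', fun s' => by
      dsimp only
      split_ifs with h
      exacts [h ▸ hcb, le_rfl]⟩ := by
    refine h.2 fun x hx => fib_le_iff.2 fun s' => ?_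
    change _ ≤ if s' = s then c else b s'
    split_ifs with h
    · subst h
      exact hc.1 ⟨x, hx, rfl⟩
    · exact fib_le x s'
  refine ⟨?_, fun y hy => le_trans ?_ (hc.2 hy)⟩
  · rintro _ ⟨x, hx, rfl⟩
    exact fib_le_iff.1 (h.1 hx) s
  · have := fib_le_iff.1 hle s
    change _ ≤ if s = s then c else b s at this
    rwa [if_pos rfl] at this

theorem fib_compl_apply {B : KBool κ} {S : Type u} {b : S → B.carrier} (x : (B.fib b).carrier)
    (s : S) : (xᶜ).1 s = b s ⊓ (x.1 s)ᶜ := rfl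

/-- A homomorphism on the base and a compatible partition induce a homomorphism on the disjoint
union. -/
theorem exists_fibHom (hκ : ℵ₀ ≤ κ) {B C : KBool κ} {S : Type u} (hS : #S < κ)
    (b : S → B.carrier) (φ : Hom B C) {e : S → C.carrier} (he : IsPartition e)
    (hle : ∀ s, e s ≤ φ (b s)) :
    ∃ h : Hom (B.fib b) C, ∀ x s, h x ⊓ e s = φ (x.1 s) ⊓ e s := by
  -- The homomorphism is glued from the pieces: `f x` is the join over `s` of `φ (x.1 s) ⊓ e s`.
  choose f hf using fun x : (B.fib b).carrier =>
    C.exists_isLUB_range hS fun s => φ (x.1 s) ⊓ e s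
  have key : ∀ x s, f x ⊓ e s = φ (x.1 s) ⊓ e s := by
    intro x s
    refine le_antisymm ?_ (le_inf ((hf x).1 ⟨s, rfl⟩) inf_le_right)
    rw [← le_himp_iff]
    refine (hf x).2 ?_
    rintro _ ⟨s', rfl⟩
    rw [le_himp_iff]
    by_cases h : s' = s
    · subst h
      exact inf_le_left
    · dsimp only
      rw [inf_assoc, he.disjoint _ _ h, inf_bot_eq]
      exact bot_le
  refine ⟨.ofCompl hκ f ?_ ?_, key⟩
  · intro x
    refine he.ext fun s => ?_
    have h1 : (f x)ᶜ ⊓ e s = (f x ⊓ e s)ᶜ ⊓ e s := by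
      rw [compl_inf, inf_sup_right, compl_inf_eq_bot, sup_bot_eq]
    rw [key, h1, key, fib_compl_apply, map_inf φ.toLatticeHom, φ.map_compl, compl_inf,
      inf_sup_right, compl_inf_eq_bot, sup_bot_eq, inf_assoc, inf_comm, inf_assoc,
      inf_eq_left.2 (hle s)]
  · intro X hX a ha
    constructor
    · rintro _ ⟨x, hx, rfl⟩
      refine he.le fun s => ?_
      rw [key]
      calc φ (x.1 s) ⊓ e s ≤ φ (a.1 s) ⊓ e s :=
            inf_le_inf_right _ (φ.mono (fib_le_iff.1 (ha.1 hx) s))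
        _ ≤ f a := (key a s).symm.trans_le inf_le_left
    · intro y hy
      refine he.le fun s => ?_
      rw [key, ← le_himp_iff]
      have := φ.map_isLUB _ (mk_image_le.trans_lt hX) _ (isLUB_fib ha hX s)
      refine this.2 ?_
      rintro _ ⟨_, ⟨x, hx, rfl⟩, rfl⟩
      rw [le_himp_iff]
      exact (key x s).symm.trans_le (inf_le_left.trans (hy ⟨x, hx, rfl⟩))

theorem fibHom_base {B C : KBool κ} {S : Type u} {b : S → B.carrier} {φ : Hom B C}
    {e : S → C.carrier} (he : IsPartition e) (hle : ∀ s, e s ≤ φ (b s)) {h : Hom (B.fib b) C}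
    (hh : ∀ x s, h x ⊓ e s = φ (x.1 s) ⊓ e s) (y : B.carrier) : h (B.fibBase b y) = φ y :=
  he.ext fun s => by
    rw [hh, fibBase_apply, map_inf φ.toLatticeHom, inf_right_comm, inf_eq_right.2 (hle s),
      inf_comm]

theorem fibHom_block {B C : KBool κ} {S : Type u} {b : S → B.carrier} {φ : Hom B C}
    {e : S → C.carrier} (he : IsPartition e) (hle : ∀ s, e s ≤ φ (b s)) {h : Hom (B.fib b) C}
    (hh : ∀ x s, h x ⊓ e s = φ (x.1 s) ⊓ e s) (p : S → Prop) {c : C.carrier}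
    (hc : ∀ s, p s → e s ≤ c) (hc' : ∀ s, ¬ p s → c ⊓ e s = ⊥) : h (B.block b p) = c :=
  he.ext fun s => by
    rw [hh, block_apply]
    split_ifs with hp
    · rw [inf_eq_right.2 (hle s), inf_eq_right.2 (hc s hp)]
    · rw [map_bot φ.toLatticeHom, bot_inf_eq, hc' s hp]

/-- On the component `s`, every `x` agrees with the pullback of the base element `x.1 s`; so
pullbacks and components determine a homomorphism. -/
theorem fib_hom_ext {B C : KBool κ} {S : Type u} (hS : #S < κ) {b : S → B.carrier}
    {φ ψ : Hom (B.fib b) C} (h1 : ∀ y, φ (B.fibBase b y) = ψ (B.fibBase b y))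
    (h2 : ∀ s, φ (B.block b fun s' => s' = s) = ψ (B.block b fun s' => s' = s)) : φ = ψ := by
  refine Hom.ext_apply fun x => ?_
  have hpart := isPartition_block B b (fun s => s)
  refine (hpart.map hS φ).ext fun s => ?_
  have : x ⊓ (B.block b fun s' => s' = s) =
      B.fibBase b (x.1 s) ⊓ (B.block b fun s' => s' = s) := by
    refine Subtype.ext (funext fun s' => ?_)
    rw [fib_inf_apply, fib_inf_apply, fibBase_apply, block_apply]
    split_ifs with h
    · subst h
      rw [inf_right_comm, inf_idem, inf_comm]
    · simp
  have hφ := congrArg φ this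
  have hψ := congrArg ψ this
  rw [map_inf φ.toLatticeHom, map_inf φ.toLatticeHom] at hφ
  rw [map_inf ψ.toLatticeHom, map_inf ψ.toLatticeHom] at hψ
  rw [hφ]
  rw [h2, hψ, h1]

/-! ### The disjoint union is presented and fiberwise `κ`-ary -/

/-- Adjoin to a presentation of `B` one generator for each component, with relations saying that
these form a partition and that the one for `s` lies below `b s`. -/
theorem IsKPresented.fib (hκ : κ.IsRegular) {B : KBool κ} {G : Type u}
    {R : Set (Term κ G × Term κ G)} {γ : G → B.carrier} (hG : #G < κ) (hR : #R < κ)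
    (hB : B.IsPresentation R γ) {S : Type u} (hS : #S < κ) (b : S → B.carrier) :
    (B.fib b).IsKPresented := by
  classical
  have hκ' := hκ.aleph0_le
  choose τ hτ using fun s => hB.eval_surjective hκ' (b s)
  let R1 : Set (Term κ (G ⊕ S) × Term κ (G ⊕ S)) :=
    (fun r => (r.1.map Sum.inl, r.2.map Sum.inl)) '' R
  -- Off the diagonal the relation is disjointness of two components; on the diagonal it says that
  -- the component `s` lies below `b s`, written as the term `τ s`.
  let R2 : Set (Term κ (G ⊕ S) × Term κ (G ⊕ S)) :=
    Set.range fun p : S × S => (Term.inf hκ' (.gen (.inr p.1))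
      (if p.1 = p.2 then .compl ((τ p.1).map Sum.inl) else .gen (.inr p.2)), Term.bot hκ')
  let R3 : Set (Term κ (G ⊕ S) × Term κ (G ⊕ S)) :=
    {(Term.iSup hS fun s => .gen (.inr s), .compl (Term.bot hκ'))}
  have hsat (C : KBool κ) (δ : G ⊕ S → C.carrier) :
      (∀ r ∈ R1 ∪ R2 ∪ R3, C.eval δ r.1 = C.eval δ r.2) ↔
        (∀ r ∈ R, C.eval (fun g => δ (.inl g)) r.1 = C.eval (fun g => δ (.inl g)) r.2) ∧
        IsPartition (fun s => δ (.inr s)) ∧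
        ∀ s, δ (.inr s) ≤ C.eval (fun g => δ (.inl g)) (τ s) := by
    have e1 : (∀ r ∈ R1, C.eval δ r.1 = C.eval δ r.2) ↔
        (∀ r ∈ R, C.eval (fun g => δ (.inl g)) r.1 = C.eval (fun g => δ (.inl g)) r.2) := by
      simp only [R1, Set.forall_mem_image, eval_map]
    have e2 : (∀ r ∈ R2, C.eval δ r.1 = C.eval δ r.2) ↔
        (∀ s s', s ≠ s' → δ (.inr s) ⊓ δ (.inr s') = ⊥) ∧
          ∀ s, δ (.inr s) ≤ C.eval (fun g => δ (.inl g)) (τ s) := by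
      simp only [R2, Set.forall_mem_range, eval_inf, eval_bot, Prod.forall]
      constructor
      · intro h
        refine ⟨fun s s' hss => ?_, fun s => ?_⟩
        · simpa [hss, eval] using h s s'
        · have := h s s
          rw [if_pos rfl, eval, eval, eval_map, ← disjoint_iff, disjoint_compl_right_iff] at this
          exact this
      · rintro ⟨h1, h2⟩ s s'
        by_cases hss : s = s'
        · rw [if_pos hss, eval, eval, eval_map, ← disjoint_iff, disjoint_compl_right_iff]
          exact h2 s
        · rw [if_neg hss]
          exact h1 s s' hss
    have e3 : (∀ r ∈ R3, C.eval δ r.1 = C.eval δ r.2) ↔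
        IsLUB (Set.range fun s => δ (.inr s)) ⊤ := by
      have h := C.isLUB_eval_iSup δ hS fun s => .gen (.inr s)
      simp only [R3, Set.mem_singleton_iff, forall_eq]
      rw [eval.eq_2, eval_bot, compl_bot]
      exact ⟨fun h' => h' ▸ h, fun h' => h.unique h'⟩
    simp only [Set.mem_union, or_imp, forall_and]
    rw [e1, e2, e3]
    exact ⟨fun h => ⟨h.1.1, ⟨h.1.2.1, h.2⟩, h.1.2.2⟩, fun h => ⟨⟨h.1, h.2.1.1, h.2.2⟩, h.2.1.2⟩⟩
  refine ⟨G ⊕ S, R1 ∪ R2 ∪ R3,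
    Sum.elim (fun g => B.fibBase b (γ g)) (fun s => B.block b fun s' => s' = s), ?_, ?_, ?_, ?_⟩
  · rw [mk_sum, lift_id, lift_id]
    exact add_lt_of_lt hκ' hG hS
  · refine (mk_union_le _ _).trans_lt (add_lt_of_lt hκ' ((mk_union_le _ _).trans_lt
      (add_lt_of_lt hκ' (mk_image_le.trans_lt hR) (mk_range_le.trans_lt ?_)))
      (mk_lt_of_finite hκ' _))
    rw [← mul_def]
    exact mul_lt_of_lt hκ' hS hS
  · rw [hsat]
    refine ⟨fun r hr => ?_, isPartition_block B b (fun s => s), fun s => ?_⟩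
    · simp only [Sum.elim_inl, ← Hom.map_eval]
      rw [hB.1 r hr]
    · simp only [Sum.elim_inl, Sum.elim_inr, ← Hom.map_eval]
      rw [hτ, fib_le_iff]
      intro s'
      rw [fibBase_apply, block_apply]
      split_ifs with h
      · rw [h, inf_idem]
      · exact bot_le
  · intro C δ hδ
    rw [hsat] at hδ
    obtain ⟨h1, he, h3⟩ := hδ
    obtain ⟨φ, hφ, -⟩ := hB.2 C (fun g => δ (.inl g)) h1
    have hle : ∀ s, δ (.inr s) ≤ φ (b s) := by
      intro s
      rw [← hτ, φ.map_eval]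
      simp only [hφ]
      exact h3 s
    obtain ⟨h, hh⟩ := exists_fibHom hκ' hS b φ he hle
    have hblock : ∀ s, h (B.block b fun s' => s' = s) = δ (.inr s) := by
      intro s
      refine fibHom_block he hle hh _ ?_ ?_
      · rintro _ rfl
        exact le_rfl
      · intro s' hs
        exact he.disjoint _ _ (Ne.symm hs)
    have hg : ∀ g, h (Sum.elim (fun g => B.fibBase b (γ g))
        (fun s => B.block b fun s' => s' = s) g) = δ g := by
      rintro (g | s)
      · exact (fibHom_base he hle hh _).trans (hφ g)
      · exact hblock s
    refine ⟨h, hg, fun h' hh' => ?_⟩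
    refine fib_hom_ext hS (fun y => ?_) fun s => ?_
    · have : (B.fibBase b).comp h' = (B.fibBase b).comp h :=
        hB.hom_ext fun g => (hh' (.inl g)).trans (hg (.inl g)).symm
      exact congrArg (fun f : Hom B C => f y) this
    · exact (hh' (.inr s)).trans (hblock s).symm

end KBool

/-! ### Fibers of the disjoint union, and cardinalities of finite choices -/

theorem mono_op_of_surjective {B A : KBool κ} (φ : B ⟶ A)
    (h : Function.Surjective (KBool.Hom.toLatticeHom φ)) : Mono φ.op where
  right_cancellation {Z} g k hgk := by
    apply Quiver.Hom.unop_inj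
    have h' : φ ≫ g.unop = φ ≫ k.unop := congrArg Quiver.Hom.unop hgk
    refine KBool.Hom.ext_apply fun x => ?_
    obtain ⟨y, rfl⟩ := h x
    exact congrArg (fun f : KBool.Hom B Z.unop => f y) h'

/-- The cover consists of the components: an element below the component `s` is the restriction of
its own `s`-coordinate, so the preimage map to that component is onto. -/
theorem isKaryToOne_fib {B : KBool κ} {S : Type u} (hS : #S < κ) (b : S → B.carrier) :
    IsKaryToOne (Quiver.Hom.op (B.fibBase b : B ⟶ B.fib b)) := by
  refine ⟨Set.range fun s => B.block b fun s' => s' = s, mk_range_le.trans_lt hS,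
    (KBool.isPartition_block B b fun s => s).isLUB, ?_⟩
  rintro _ ⟨s, rfl⟩
  refine mono_op_of_surjective
    ((B.fibBase b : B ⟶ B.fib b) ≫ (B.fib b).toBelow (B.block b fun s' => s' = s)) ?_
  rintro ⟨z, hz⟩
  refine ⟨z.1 s, Subtype.ext (Subtype.ext (funext fun s' => ?_))⟩
  change (B.block b fun s' => s' = s).1 s' ⊓ (b s' ⊓ z.1 s) = z.1 s'
  have h1 := KBool.fib_le_iff.1 hz s'
  have h2 := KBool.fib_le z s'
  rw [KBool.block_apply] at h1 ⊢
  split_ifs at h1 ⊢ with h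
  · subst h
    rw [inf_eq_right.2 h2, inf_eq_right.2 h2]
  · rw [bot_inf_eq, le_bot_iff.1 h1]

theorem mk_finset_lt (hκ : ℵ₀ ≤ κ) {T : Type u} (hT : #T < κ) : #(Finset T) < κ := by
  cases finite_or_infinite T
  · exact (lt_aleph0_of_finite _).trans_le hκ
  · rwa [mk_finset_of_infinite]

/-- Regularity bounds the disjoint union of all `V t`, and a finite power of it stays below `κ`. -/
theorem mk_pi_finset_lt (hκ : κ.IsRegular) {T : Type u} (hT : #T < κ) {V : T → Type u}
    (hV : ∀ t, #(V t) < κ) (F : Finset T) : #(∀ t : F, V t) < κ := by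
  have hW : #(Σ t, V t) < κ := by
    rw [mk_sigma]
    exact sum_lt_of_isRegular hκ hT hV
  have hle : #(∀ t : F, V t) ≤ #(F → Σ t, V t) := by
    refine ⟨⟨fun s t => ⟨t, s t⟩, fun s s' h => funext fun t => ?_⟩⟩
    exact eq_of_heq (Sigma.mk.inj_iff.1 (congrFun h t)).2
  refine hle.trans_lt ?_
  cases finite_or_infinite (Σ t, V t)
  · exact (lt_aleph0_of_finite _).trans_le hκ.aleph0_le
  · rw [← power_def, mk_coe_finset]
    exact (power_nat_le (aleph0_le_mk _)).trans_lt hW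

namespace KBool

/-! ### Systems of pairwise constraints and their finite stages -/

section System

variable {B : KBool κ} {T : Type u} {V : T → Type u} (β : ∀ t t', V t → V t' → B.carrier)

/-- Choices `e t v` of the region where the coordinate `t` has value `v`, subject to the
pairwise constraints `β`, in an algebra `C` over `B`. -/
structure IsModel {C : KBool κ} (φ : Hom B C) (e : ∀ t, V t → C.carrier) : Prop where
  isPartition : ∀ t, IsPartition (e t)
  le : ∀ t t' v v', e t v ⊓ e t' v' ≤ φ (β t t' v v')

/-- The largest Borel set of the base over which the finitely many coordinates may have the
values `s`. -/
def bnd (F : Finset T) (s : ∀ t : F, V t) : B.carrier :=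
  Finset.univ.inf fun p : F × F => β p.1 p.2 (s p.1) (s p.2)

/-- The algebra over `B` classifying the values of finitely many coordinates. -/
abbrev stage (F : Finset T) : KBool κ := B.fib (bnd β F)

/-- The structure homomorphism of a stage. -/
abbrev stageBase (F : Finset T) : Hom B (stage β F) := B.fibBase (bnd β F)

/-- The region of a stage where a coordinate has a given value. -/
noncomputable def region (F : Finset T) (t : T) (ht : t ∈ F) (v : V t) : (stage β F).carrier :=
  B.block (bnd β F) fun s => s ⟨t, ht⟩ = v

theorem isPartition_region (F : Finset T) (t : T) (ht : t ∈ F) :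
    IsPartition (region β F t ht) :=
  isPartition_block B (bnd β F) fun s => s ⟨t, ht⟩

theorem region_inf_le (F : Finset T) (t t' : T) (ht : t ∈ F) (ht' : t' ∈ F) (v : V t)
    (v' : V t') : region β F t ht v ⊓ region β F t' ht' v' ≤ stageBase β F (β t t' v v') := by
  rw [fib_le_iff]
  intro s
  rw [fib_inf_apply, region, region, block_apply, block_apply, fibBase_apply]
  split_ifs with h h'
  · subst h
    subst h'
    rw [inf_idem]
    have : bnd β F s ≤ β t t' (s ⟨t, ht⟩) (s ⟨t', ht'⟩) :=
      Finset.inf_le (f := fun p : F × F => β p.1 p.2 (s p.1) (s p.2))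
        (b := (⟨t, ht⟩, ⟨t', ht'⟩)) (Finset.mem_univ _)
    exact le_inf le_rfl this
  all_goals simp

variable {β}

/-- The common refinement of the partitions `e t` is indexed by the assignments `s`, and the
pairwise constraints put its piece at `s` below `φ (bnd β F s)`; this is what a map out of the
disjoint union requires. -/
theorem exists_stageHom (hκ : κ.IsRegular) (hT : #T < κ) (hV : ∀ t, #(V t) < κ)
    [∀ t, Nonempty (V t)] (F : Finset T) {C : KBool κ} (φ : Hom B C)
    {e : ∀ t : F, V t → C.carrier} (he : ∀ t, IsPartition (e t))
    (hle : ∀ t t' v v', e t v ⊓ e t' v' ≤ φ (β t t' v v')) :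
    ∃ h : Hom (stage β F) C, (∀ y, h (stageBase β F y) = φ y) ∧
      ∀ t ht v, h (region β F t ht v) = e ⟨t, ht⟩ v := by
  have hpart := IsPartition.finset_inf he
  have hle' : ∀ s : ∀ t : F, V t, (Finset.univ.inf fun t => e t (s t)) ≤ φ (bnd β F s) := by
    intro s
    rw [bnd, map_finset_inf φ.toLatticeHom]
    refine Finset.le_inf fun p _ => le_trans (le_inf ?_ ?_) (hle p.1 p.2 (s p.1) (s p.2))
    · exact Finset.inf_le (f := fun t => e t (s t)) (Finset.mem_univ p.1)
    · exact Finset.inf_le (f := fun t => e t (s t)) (Finset.mem_univ p.2)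
  obtain ⟨h, hh⟩ := exists_fibHom hκ.aleph0_le (mk_pi_finset_lt hκ hT hV F) (bnd β F) φ hpart hle'
  refine ⟨h, fibHom_base hpart hle' hh, fun t ht v => fibHom_block hpart hle' hh _ ?_ ?_⟩
  · rintro s rfl
    exact Finset.inf_le (f := fun t => e t (s t)) (Finset.mem_univ (⟨t, ht⟩ : F))
  · intro s hs
    rw [eq_bot_iff, ← (he ⟨t, ht⟩).disjoint _ _ (Ne.symm hs)]
    exact inf_le_inf_left _
      (Finset.inf_le (f := fun t => e t (s t)) (Finset.mem_univ (⟨t, ht⟩ : F)))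

/-- The component of `s` is the part over `bnd β F s` of the intersection of the regions `s t`, so
the base and the regions generate the stage. -/
theorem stage_hom_ext (hκ : κ.IsRegular) (hT : #T < κ) (hV : ∀ t, #(V t) < κ)
    (F : Finset T) {C : KBool κ} {φ ψ : Hom (stage β F) C}
    (h1 : ∀ y, φ (stageBase β F y) = ψ (stageBase β F y))
    (h2 : ∀ t ht v, φ (region β F t ht v) = ψ (region β F t ht v)) : φ = ψ := by
  refine fib_hom_ext (mk_pi_finset_lt hκ hT hV F) h1 fun s => ?_
  have : (B.block (bnd β F) fun s' => s' = s) =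
      B.fibBase (bnd β F) (bnd β F s) ⊓
        Finset.univ.inf fun t : F => region β F t.1 t.2 (s t) := by
    refine le_antisymm (le_inf ?_ (Finset.le_inf fun t _ => ?_)) ?_
    · rw [fib_le_iff]
      intro s'
      rw [block_apply, fibBase_apply]
      split_ifs with h
      · rw [h, inf_idem]
      · exact bot_le
    · rw [fib_le_iff]
      intro s'
      rw [region, block_apply, block_apply]
      split_ifs with h h'
      · exact le_rfl
      · exact absurd (congrFun h t) h'
      · exact bot_le
      · exact bot_le
    · rw [fib_le_iff]
      intro s'
      rw [block_apply]
      split_ifs with h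
      · exact fib_le _ _
      · obtain ⟨t, ht⟩ := Function.ne_iff.1 h
        have := fib_le_iff.1 (inf_le_right.trans (Finset.inf_le (Finset.mem_univ t)) :
          B.fibBase (bnd β F) (bnd β F s) ⊓ (Finset.univ.inf fun t : F => region β F t.1 t.2 (s t))
            ≤ region β F t.1 t.2 (s t)) s'
        rwa [region, block_apply, if_neg ht] at this
  rw [this, map_inf φ.toLatticeHom, map_inf ψ.toLatticeHom, h1, map_finset_inf φ.toLatticeHom,
    map_finset_inf ψ.toLatticeHom]
  congr 2
  exact funext fun t => h2 t.1 t.2 (s t)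

theorem exists_transition (hκ : κ.IsRegular) (hT : #T < κ) (hV : ∀ t, #(V t) < κ)
    [∀ t, Nonempty (V t)] {F F' : Finset T} (hF : F ≤ F') :
    ∃ h : Hom (stage β F) (stage β F'), (∀ y, h (stageBase β F y) = stageBase β F' y) ∧
      ∀ t ht v, h (region β F t ht v) = region β F' t (hF ht) v :=
  exists_stageHom hκ hT hV F (stageBase β F')
    (fun t => isPartition_region β F' t (hF t.2))
    fun t t' => region_inf_le β F' t t' (hF t.2) (hF t'.2)

/-- The homomorphism from a stage to a later one. -/
noncomputable def transition (hκ : κ.IsRegular) (hT : #T < κ) (hV : ∀ t, #(V t) < κ)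
    [∀ t, Nonempty (V t)] {F F' : Finset T} (hF : F ≤ F') : Hom (stage β F) (stage β F') :=
  (exists_transition hκ hT hV hF).choose

theorem transition_base (hκ : κ.IsRegular) (hT : #T < κ) (hV : ∀ t, #(V t) < κ)
    [∀ t, Nonempty (V t)] {F F' : Finset T} (hF : F ≤ F') (y : B.carrier) :
    transition (β := β) hκ hT hV hF (stageBase β F y) = stageBase β F' y :=
  (exists_transition hκ hT hV hF).choose_spec.1 y

theorem transition_region (hκ : κ.IsRegular) (hT : #T < κ) (hV : ∀ t, #(V t) < κ)
    [∀ t, Nonempty (V t)] {F F' : Finset T} (hF : F ≤ F') (t : T) (ht : t ∈ F) (v : V t) :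
    transition hκ hT hV hF (region β F t ht v) = region β F' t (hF ht) v :=
  (exists_transition hκ hT hV hF).choose_spec.2 t ht v

variable (β)

/-- The diagram, over the base, of the stages of a system. -/
noncomputable def stageDiagram (hκ : κ.IsRegular) (hT : #T < κ) (hV : ∀ t, #(V t) < κ)
    [∀ t, Nonempty (V t)] :
    (Finset T)ᵒᵖ ⥤ Over (Opposite.op B) where
  obj F := Over.mk (Quiver.Hom.op (stageBase β F.unop : B ⟶ stage β F.unop))
  map {F F'} i := Over.homMk
    (Quiver.Hom.op (transition hκ hT hV (leOfHom i.unop) : stage β F'.unop ⟶ stage β F.unop))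
    (Quiver.Hom.unop_inj (Hom.ext_apply (transition_base hκ hT hV (leOfHom i.unop))))
  map_id F := by
    refine Over.OverMorphism.ext (Quiver.Hom.unop_inj ?_)
    exact stage_hom_ext hκ hT hV F.unop (transition_base hκ hT hV le_rfl)
      (transition_region hκ hT hV le_rfl)
  map_comp {F F' F''} i j := by
    refine Over.OverMorphism.ext (Quiver.Hom.unop_inj ?_)
    refine stage_hom_ext hκ hT hV F''.unop (fun y => ?_) fun t ht v => ?_
    · refine (transition_base hκ hT hV _ y).trans (Eq.symm ?_)
      exact (congrArg (transition hκ hT hV (leOfHom i.unop)) (transition_base hκ hT hV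
        (leOfHom j.unop) y)).trans (transition_base hκ hT hV _ y)
    · refine (transition_region hκ hT hV _ t ht v).trans (Eq.symm ?_)
      exact (congrArg (transition hκ hT hV (leOfHom i.unop)) (transition_region hκ hT hV
        (leOfHom j.unop) t ht v)).trans (transition_region hκ hT hV _ t _ v)

end System

/-- If `A` is the algebra over `B` classifying the models of a system of fewer than `κ`
coordinates with fewer than `κ` values each, then it is dual to a codirected limit of fiberwise
`κ`-ary locales. -/
theorem isCodirectedLimit_of_isModel (hκ : κ.IsRegular) {B A : KBool κ} {T : Type u}
    (hB : B.IsKPresented) (hT : #T < κ) {V : T → Type u} (hV : ∀ t, #(V t) < κ)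
    [∀ t, Nonempty (V t)] (β : ∀ t t', V t → V t' → B.carrier) (f : Hom B A)
    (e : ∀ t, V t → A.carrier) (he : IsModel β f e)
    (hex : ∀ (C : KBool κ) (φ : Hom B C) (e' : ∀ t, V t → C.carrier), IsModel β φ e' →
      ∃ θ : Hom A C, (∀ y, θ (f y) = φ y) ∧ ∀ t v, θ (e t v) = e' t v)
    (hext : ∀ (C : KBool κ) (θ θ' : Hom A C), (∀ t v, θ (e t v) = θ' (e t v)) → θ = θ') :
    IsCodirectedLimitOfFiberwiseKary (Quiver.Hom.op (f : B ⟶ A)) := by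
  classical
  choose leg hleg1 hleg2 using fun F : Finset T => exists_stageHom hκ hT hV F f
    (fun t : F => he.isPartition t) (fun t t' => he.le t t')
  refine ⟨Finset T, inferInstance, stageDiagram β hκ hT hV, ⟨∅⟩, inferInstance,
    mk_finset_lt hκ.aleph0_le hT, fun F => ⟨?_, isKaryToOne_fib
      (mk_pi_finset_lt hκ hT hV F.unop) _⟩, ?_⟩
  · obtain ⟨G, R, γ, hG, hR, h⟩ := hB
    exact IsKPresented.fib hκ hG hR h (mk_pi_finset_lt hκ hT hV F.unop) _
  let c : Limits.Cone (stageDiagram β hκ hT hV) :=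
    { pt := Over.mk (Quiver.Hom.op (f : B ⟶ A))
      π :=
        { app := fun F => Over.homMk (Quiver.Hom.op (leg F.unop : stage β F.unop ⟶ A))
            (Quiver.Hom.unop_inj (Hom.ext_apply (hleg1 F.unop)))
          naturality := by
            intro F F' i
            refine Over.OverMorphism.ext (Quiver.Hom.unop_inj ?_)
            refine stage_hom_ext hκ hT hV F'.unop (fun y => ?_) fun t ht v => ?_
            · refine (hleg1 F'.unop y).trans (Eq.symm ?_)
              exact (congrArg (leg F.unop) (transition_base hκ hT hV (leOfHom i.unop) y)).trans
                (hleg1 F.unop y)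
            · refine (hleg2 F'.unop t ht v).trans (Eq.symm ?_)
              exact (congrArg (leg F.unop)
                (transition_region hκ hT hV (leOfHom i.unop) t ht v)).trans
                (hleg2 F.unop t _ v) } }
  refine ⟨c, ⟨?_⟩, ⟨Iso.refl _⟩⟩
  have key (s : Limits.Cone (stageDiagram β hκ hT hV)) :
      ∃! m : s.pt ⟶ c.pt, ∀ F, m ≫ c.π.app F = s.π.app F := by
    let C : KBool κ := s.pt.left.unop
    let φ : Hom B C := s.pt.hom.unop
    let l (F : Finset T) : Hom (stage β F) C := (s.π.app (Opposite.op F)).left.unop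
    have hl (F : Finset T) (y : B.carrier) : l F (stageBase β F y) = φ y :=
      congrArg (fun g : s.pt.left ⟶ Opposite.op B => Hom.toLatticeHom (A := B) (B := C) g.unop y)
        (Over.w (s.π.app (Opposite.op F)))
    have hlt {F F' : Finset T} (h : F ≤ F') (x : (stage β F).carrier) :
        l F' (transition hκ hT hV h x) = l F x :=
      congrArg (fun g => Hom.toLatticeHom (A := stage β F) (B := C) (CommaMorphism.left g).unop x)
        (s.w (Quiver.Hom.op (homOfLE h)))
    -- The value of the coordinate `t` is read off at the stage `{t}`; compatibility transports it
    -- to every stage containing `t`.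
    let e' (t : T) (v : V t) : C.carrier :=
      l {t} (region β {t} t (Finset.mem_singleton_self t) v)
    have hle' (F : Finset T) (t : T) (ht : t ∈ F) (v : V t) :
        l F (region β F t ht v) = e' t v := by
      have h : ({t} : Finset T) ≤ F := Finset.singleton_subset_iff.2 ht
      rw [← transition_region hκ hT hV h t (Finset.mem_singleton_self t) v]
      exact hlt h _
    -- Each constraint concerns only `t` and `t'`, so it already holds at the stage `{t, t'}`.
    have hm : IsModel β φ e' := by
      refine ⟨fun t => (isPartition_region β {t} t _).map (hV t) _, fun t t' v v' => ?_⟩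
      have ht : t ∈ ({t, t'} : Finset T) := by simp
      have ht' : t' ∈ ({t, t'} : Finset T) := by simp
      rw [← hle' {t, t'} t ht v, ← hle' {t, t'} t' ht' v', ← hl {t, t'},
        ← map_inf (l {t, t'}).toLatticeHom]
      exact (l {t, t'}).mono (region_inf_le β _ t t' ht ht' v v')
    obtain ⟨θ, hθ1, hθ2⟩ := hex C φ e' hm
    refine ⟨Over.homMk (Quiver.Hom.op (θ : A ⟶ C))
      (Quiver.Hom.unop_inj (Hom.ext_apply hθ1)), fun F => ?_, fun m hmF => ?_⟩
    · refine Over.OverMorphism.ext (Quiver.Hom.unop_inj ?_)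
      refine stage_hom_ext hκ hT hV F.unop (fun y => ?_) fun t ht v => ?_
      · exact (congrArg θ (hleg1 F.unop y)).trans ((hθ1 y).trans (hl F.unop y).symm)
      · exact (congrArg θ (hleg2 F.unop t ht v)).trans
          ((hθ2 t v).trans (hle' F.unop t ht v).symm)
    · refine Over.OverMorphism.ext (Quiver.Hom.unop_inj ?_)
      refine hext C m.left.unop θ fun t v => ?_
      rw [hθ2, ← hleg2 {t} t (Finset.mem_singleton_self t) v]
      exact congrArg (fun g => Hom.toLatticeHom (A := stage β {t}) (B := C)
        (CommaMorphism.left g).unop (region β {t} t (Finset.mem_singleton_self t) v)) (hmF (Opposite.op {t}))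
  choose m hm hm' using key
  exact ⟨m, fun s F => hm s F, fun s m' h => hm' s m' h⟩

/-! ### Subterms -/

/-- The set of subterms of a term. -/
def Term.subterms {G : Type u} : Term κ G → Set (Term κ G)
  | .gen g => {.gen g}
  | .compl t => insert (.compl t) t.subterms
  | .sup s hs t => insert (.sup s hs t) (⋃ i, (t i).subterms)

theorem Term.self_mem_subterms {G : Type u} (t : Term κ G) : t ∈ t.subterms := by
  cases t with
  | gen g => exact rfl
  | compl t => exact Set.mem_insert _ _
  | sup s hs t => exact Set.mem_insert _ _

/-- Regularity enters at joins, as a union of fewer than `κ` sets of size below `κ`. -/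
theorem Term.mk_subterms_lt (hκ : κ.IsRegular) {G : Type u} (t : Term κ G) :
    #t.subterms < κ := by
  have hins (U : Set (Term κ G)) (x : Term κ G) (hU : #U < κ) : #(insert x U : Set _) < κ :=
    mk_insert_le.trans_lt (add_lt_of_lt hκ.aleph0_le hU (one_lt_aleph0.trans_le hκ.aleph0_le))
  induction t with
  | gen g => exact mk_lt_of_finite hκ.aleph0_le ({Term.gen g} : Set (Term κ G))
  | compl t ih => exact hins _ _ ih
  | sup s hs t ih => exact hins _ _ ((card_iUnion_lt_iff_forall_of_isRegular hκ hs).2 ih)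

/-- A set of terms containing all subterms of its members. -/
structure SubtermClosed {G : Type u} (U : Set (Term κ G)) : Prop where
  compl : ∀ t, .compl t ∈ U → t ∈ U
  sup : ∀ s hs t, .sup s hs t ∈ U → ∀ i, t i ∈ U

theorem SubtermClosed.iUnion {G ι : Type u} {U : ι → Set (Term κ G)}
    (h : ∀ i, SubtermClosed (U i)) : SubtermClosed (⋃ i, U i) where
  compl t ht := by
    obtain ⟨i, hi⟩ := Set.mem_iUnion.1 ht
    exact Set.mem_iUnion.2 ⟨i, (h i).compl t hi⟩
  sup s hs t ht j := by
    obtain ⟨i, hi⟩ := Set.mem_iUnion.1 ht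
    exact Set.mem_iUnion.2 ⟨i, (h i).sup s hs t hi j⟩

theorem Term.subtermClosed_subterms {G : Type u} (t : Term κ G) : SubtermClosed t.subterms := by
  induction t with
  | gen g => exact ⟨fun t h => (by cases h), fun s hs t h => (by cases h)⟩
  | compl t ih =>
    refine ⟨fun t' h => ?_, fun s hs t' h i => ?_⟩
    · rcases h with h | h
      · cases h
        exact Set.mem_insert_of_mem _ t.self_mem_subterms
      · exact Set.mem_insert_of_mem _ (ih.compl _ h)
    · rcases h with h | h
      · cases h
      · exact Set.mem_insert_of_mem _ (ih.sup _ _ _ h i)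
  | sup s hs t ih =>
    have ih' := SubtermClosed.iUnion ih
    refine ⟨fun t' h => ?_, fun s hs t' h i => ?_⟩
    · rcases h with h | h
      · cases h
      · exact Set.mem_insert_of_mem _ (ih'.compl _ h)
    · rcases h with h | h
      · cases h
        exact Set.mem_insert_of_mem _ (Set.mem_iUnion.2 ⟨i, (t i).self_mem_subterms⟩)
      · exact Set.mem_insert_of_mem _ (ih'.sup _ _ _ h i)

theorem exists_subtermClosed (hκ : κ.IsRegular) {G : Type u} (U : Set (Term κ G)) (hU : #U < κ) :
    ∃ U' : Set (Term κ G), U ⊆ U' ∧ #U' < κ ∧ SubtermClosed U' :=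
  ⟨⋃ t : U, t.1.subterms, fun t ht => Set.mem_iUnion.2 ⟨⟨t, ht⟩, t.self_mem_subterms⟩,
    (card_iUnion_lt_iff_forall_of_isRegular hκ hU).2 fun t => t.1.mk_subterms_lt hκ,
    .iUnion fun t => t.1.subtermClosed_subterms⟩

/-! ### Partitions indexed by an option type -/

theorem IsPartition.le_none {C : KBool κ} {W : Type u} {e : Option W → C.carrier}
    (he : IsPartition e) {x : C.carrier} (h : ∀ i, x ⊓ e (some i) = ⊥) : x ≤ e none :=
  he.le fun v => by
    cases v with
    | none => exact inf_le_right
    | some i => exact (h i).trans_le bot_le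

theorem IsPartition.compl_none_le {C : KBool κ} {W : Type u} {e : Option W → C.carrier}
    (he : IsPartition e) {y : C.carrier} (h : ∀ i, e (some i) ≤ y) : (e none)ᶜ ≤ y :=
  he.le fun v => by
    cases v with
    | none => exact compl_inf_eq_bot.trans_le bot_le
    | some i => exact inf_le_right.trans (h i)

theorem IsPartition.some_le_compl_none {C : KBool κ} {W : Type u} {e : Option W → C.carrier}
    (he : IsPartition e) (i : W) : e (some i) ≤ (e none)ᶜ :=
  le_compl_iff_disjoint_right.2 (disjoint_iff.2 (he.disjoint _ _ (Option.some_ne_none i)))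

theorem IsPartition.some_eq_compl_none {C : KBool κ} {e : Option PUnit.{u + 1} → C.carrier}
    (he : IsPartition e) (i : PUnit) : e (some i) = (e none)ᶜ :=
  le_antisymm (he.some_le_compl_none i) (he.compl_none_le fun _ => le_rfl)

theorem isPartition_pair {C : KBool κ} {e : Option PUnit.{u + 1} → C.carrier}
    (h : ∀ i, e (some i) = (e none)ᶜ) : IsPartition e where
  disjoint v v' hv := by
    rcases v with _ | ⟨⟨⟩⟩ <;> rcases v' with _ | ⟨⟨⟩⟩
    · exact absurd rfl hv
    · rw [h, inf_compl_eq_bot]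
    · rw [h, compl_inf_eq_bot]
    · exact absurd rfl hv
  isLUB := ⟨fun _ _ => le_top, fun y hy => by
    rw [← sup_compl_eq_top (x := e none), ← h ⟨⟩]
    exact sup_le (hy ⟨_, rfl⟩) (hy ⟨_, rfl⟩)⟩

/-! ### The system of constraints of a presentation -/

section TermSystem

variable {G J : Type u} {B : KBool κ}

/-- The possible witnesses for the truth of a term: for a join, the first true member. -/
def Term.Witness {G : Type u} : Term κ G → Type u
  | .gen _ => PUnit
  | .compl _ => PUnit
  | .sup s _ _ => s

theorem Term.mk_option_witness_lt (hκ : ℵ₀ ≤ κ) (t : Term κ G) : #(Option t.Witness) < κ := by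
  rw [mk_option]
  refine add_lt_of_lt hκ ?_ (one_lt_aleph0.trans_le hκ)
  cases t with
  | gen g => exact mk_lt_of_finite hκ PUnit
  | compl t => exact mk_lt_of_finite hκ PUnit
  | sup s hs t => exact hs

/-- Compatibility of the first true member of a join with the truth values of the members. -/
def Term.SupCompat {G : Type u} :
    (t t' : Term κ G) → Option t.Witness → Option t'.Witness → Prop
  | .sup s _ t, t', v, v' => ∀ j : s, t j = t' → (v = none → v' = none) ∧
      ∀ i : s, v = some i → (j = i → v' ≠ none) ∧ (WellOrderingRel j.1 i.1 → v' = none)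
  | .gen _, _, _, _ => True
  | .compl _, _, _, _ => True

/-- Compatibility of the truth values of two terms, given the relations `R`. -/
structure Term.Compat (R : Set (Term κ G × Term κ G)) (t t' : Term κ G) (v : Option t.Witness)
    (v' : Option t'.Witness) : Prop where
  compl : t = .compl t' → (v = none ↔ v' ≠ none)
  rel : (t, t') ∈ R → (v = none ↔ v' = none)
  sup : t.SupCompat t' v v'

open Classical in
/-- The region of the base where a term may have a given truth value: a constraint only for the
generators that come from the base. -/
noncomputable def Term.baseRegion (γB : J → B.carrier) :
    (t : Term κ (G ⊕ J)) → Option t.Witness → B.carrier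
  | .gen (.inr j), v => if v = none then (γB j)ᶜ else γB j
  | .gen (.inl _), _ => ⊤
  | .compl _, _ => ⊤
  | .sup _ _ _, _ => ⊤

open Classical in
/-- The pairwise constraints between the truth values of terms. -/
noncomputable def termConstraint (γB : J → B.carrier)
    (R : Set (Term κ (G ⊕ J) × Term κ (G ⊕ J))) (U : Set (Term κ (G ⊕ J)))
    (t t' : U) (v : Option t.1.Witness) (v' : Option t'.1.Witness) : B.carrier :=
  if Term.Compat R t.1 t'.1 v v' then t.1.baseRegion γB v else ⊥

variable {γB : J → B.carrier} {R : Set (Term κ (G ⊕ J) × Term κ (G ⊕ J))}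
  {U : Set (Term κ (G ⊕ J))} {C : KBool κ} {φ : Hom B C}
  {e : ∀ t : U, Option t.1.Witness → C.carrier}

theorem IsModel.inf_eq_bot (h : IsModel (termConstraint γB R U) φ e) {t t' : U}
    {v : Option t.1.Witness} {v' : Option t'.1.Witness} (hv : ¬ Term.Compat R t.1 t'.1 v v') :
    e t v ⊓ e t' v' = ⊥ := by
  have := h.le t t' v v'
  rwa [termConstraint, if_neg hv, map_bot φ.toLatticeHom, le_bot_iff] at this

theorem IsModel.le_baseRegion (h : IsModel (termConstraint γB R U) φ e) (t : U)
    (v : Option t.1.Witness) : e t v ≤ φ (t.1.baseRegion γB v) := by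
  -- The unary constraint on `t` is the pairwise one at `(t, t)`.
  have := h.le t t v v
  rw [inf_idem] at this
  refine this.trans (φ.mono ?_)
  rw [termConstraint]
  split_ifs
  exacts [le_rfl, bot_le]

theorem IsModel.map {D : KBool κ} (hκ : ℵ₀ ≤ κ) (h : IsModel (termConstraint γB R U) φ e)
    (θ : Hom C D) : IsModel (termConstraint γB R U) (φ.comp θ) fun t v => θ (e t v) where
  isPartition t := (h.isPartition t).map (t.1.mk_option_witness_lt hκ) θ
  le t t' v v' := by
    rw [← map_inf θ.toLatticeHom]
    exact θ.mono (h.le t t' v v')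

/-- `(e t none)ᶜ` is the region where `t` is declared true. For a join, a witness forces its member
to be true, and a true member excludes `none`; with complements this drives the induction on terms.
-/
theorem IsModel.eval_eq (hU : SubtermClosed U) (hgen : ∀ g, .gen g ∈ U)
    (h : IsModel (termConstraint γB R U) φ e) (t : Term κ (G ⊕ J)) (ht : t ∈ U) :
    C.eval (fun g => (e ⟨.gen g, hgen g⟩ none)ᶜ) t = (e ⟨t, ht⟩ none)ᶜ := by
  induction t with
  | gen g => rfl
  | compl t ih =>
    have ht' := hU.compl t ht
    rw [eval, ih ht', compl_compl]
    refine le_antisymm ?_ ?_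
    · rw [le_compl_iff_disjoint_right, disjoint_iff, inf_comm]
      exact h.inf_eq_bot fun hc => (hc.compl rfl).1 rfl rfl
    · refine (h.isPartition ⟨.compl t, ht⟩).compl_none_le fun i => ?_
      refine (h.isPartition ⟨t, ht'⟩).le_none fun j => ?_
      exact h.inf_eq_bot fun hc => absurd ((hc.compl rfl).2 (Option.some_ne_none j))
        (Option.some_ne_none i)
  | sup s hs t ih =>
    have ht' := hU.sup s hs t ht
    refine (C.isLUB_eval_sup _ s hs t).unique ?_
    simp only [ih _ (ht' _)]
    constructor
    · rintro _ ⟨i, rfl⟩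
      refine (h.isPartition ⟨t i, ht' i⟩).compl_none_le fun j => ?_
      rw [le_compl_iff_disjoint_right, disjoint_iff, inf_comm]
      exact h.inf_eq_bot fun hc => Option.some_ne_none j ((hc.sup i rfl).1 rfl)
    · intro y hy
      refine (h.isPartition ⟨.sup s hs t, ht⟩).compl_none_le fun i => ?_
      refine le_trans ?_ (hy ⟨i, rfl⟩)
      rw [le_compl_iff_disjoint_right, disjoint_iff]
      exact h.inf_eq_bot fun hc => ((hc.sup i rfl).2 i rfl).1 rfl rfl

theorem IsModel.eval_rel (hU : SubtermClosed U) (hgen : ∀ g, .gen g ∈ U)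
    (hR : ∀ r ∈ R, r.1 ∈ U ∧ r.2 ∈ U) (h : IsModel (termConstraint γB R U) φ e) :
    ∀ r ∈ R, C.eval (fun g => (e ⟨.gen g, hgen g⟩ none)ᶜ) r.1 =
      C.eval (fun g => (e ⟨.gen g, hgen g⟩ none)ᶜ) r.2 := by
  rintro ⟨t, t'⟩ hr
  rw [h.eval_eq hU hgen t (hR _ hr).1, h.eval_eq hU hgen t' (hR _ hr).2]
  congr 1
  refine le_antisymm ?_ ?_
  · refine (h.isPartition ⟨t', (hR _ hr).2⟩).le_none fun j => ?_
    exact h.inf_eq_bot fun hc => Option.some_ne_none j ((hc.rel hr).1 rfl)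
  · refine (h.isPartition ⟨t, (hR _ hr).1⟩).le_none fun j => ?_
    rw [inf_comm]
    exact h.inf_eq_bot fun hc => Option.some_ne_none j ((hc.rel hr).2 rfl)

/-- The base regions bound both the true and the false part from above; as these two parts are
complementary, equality follows. -/
theorem IsModel.gen_inr (hgen : ∀ g, .gen g ∈ U) (h : IsModel (termConstraint γB R U) φ e)
    (j : J) : (e ⟨.gen (.inr j), hgen _⟩ none)ᶜ = φ (γB j) := by
  refine le_antisymm ?_ ?_
  · refine (h.isPartition ⟨.gen (.inr j), hgen _⟩).compl_none_le fun i => ?_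
    have := h.le_baseRegion ⟨.gen (.inr j), hgen _⟩ (some i)
    rwa [Term.baseRegion, if_neg (Option.some_ne_none i)] at this
  · have := h.le_baseRegion ⟨.gen (.inr j), hgen _⟩ none
    rw [Term.baseRegion, if_pos rfl, φ.map_compl] at this
    exact le_compl_comm.1 this

/-- The generators fix all truth values by `IsModel.eval_eq`. Witnesses then agree as well: if `j`
precedes `i`, first witness `i` in one model makes the member `j` false, while witness `j` in the
other makes it true. -/
theorem IsModel.unique (hU : SubtermClosed U) (hgen : ∀ g, .gen g ∈ U)
    (h : IsModel (termConstraint γB R U) φ e) {φ' : Hom B C}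
    {e' : ∀ t : U, Option t.1.Witness → C.carrier}
    (h' : IsModel (termConstraint γB R U) φ' e')
    (H : ∀ g, (e ⟨.gen g, hgen g⟩ none)ᶜ = (e' ⟨.gen g, hgen g⟩ none)ᶜ) (t : U)
    (v : Option t.1.Witness) : e t v = e' t v := by
  have hnone (t : U) : (e t none)ᶜ = (e' t none)ᶜ := by
    rw [← h.eval_eq hU hgen t.1 t.2, ← h'.eval_eq hU hgen t.1 t.2]
    simp only [H]
  have hdisj {f f' : ∀ t : U, Option t.1.Witness → C.carrier} {φ φ' : Hom B C}
      (h : IsModel (termConstraint γB R U) φ f) (h' : IsModel (termConstraint γB R U) φ' f')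
      (hn : ∀ t : U, (f t none)ᶜ = (f' t none)ᶜ)
      (s : Set κ.out) (hs : #s < κ) (t : s → Term κ (G ⊕ J)) (ht : .sup s hs t ∈ U) (i j : s)
      (hij : WellOrderingRel j.1 i.1) :
      f ⟨.sup s hs t, ht⟩ (some i) ⊓ f' ⟨.sup s hs t, ht⟩ (some j) = ⊥ := by
    have ht' := hU.sup s hs t ht
    have h1 : f' ⟨.sup s hs t, ht⟩ (some j) ≤ (f' ⟨t j, ht' j⟩ none)ᶜ := by
      rw [le_compl_iff_disjoint_right, disjoint_iff]
      exact h'.inf_eq_bot fun hc => ((hc.sup j rfl).2 j rfl).1 rfl rfl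
    have h2 : f ⟨.sup s hs t, ht⟩ (some i) ≤ f ⟨t j, ht' j⟩ none := by
      refine (h.isPartition ⟨t j, ht' j⟩).le_none fun k => ?_
      exact h.inf_eq_bot fun hc => Option.some_ne_none k (((hc.sup j rfl).2 i rfl).2 hij)
    rw [← hn] at h1
    rw [eq_bot_iff, ← inf_compl_eq_bot (a := f ⟨t j, ht' j⟩ none)]
    exact inf_le_inf h2 h1
  obtain ⟨t, ht⟩ := t
  cases v with
  | none => exact compl_injective (hnone ⟨t, ht⟩)
  | some i =>
    cases t with
    | gen g =>
      exact ((h.isPartition ⟨.gen g, ht⟩).some_eq_compl_none i).trans ((hnone _).trans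
        ((h'.isPartition ⟨.gen g, ht⟩).some_eq_compl_none i).symm)
    | compl t =>
      exact ((h.isPartition ⟨.compl t, ht⟩).some_eq_compl_none i).trans ((hnone _).trans
        ((h'.isPartition ⟨.compl t, ht⟩).some_eq_compl_none i).symm)
    | sup s hs t =>
      have hle {f f' : ∀ t : U, Option t.1.Witness → C.carrier} {φ φ' : Hom B C}
          (h : IsModel (termConstraint γB R U) φ f) (h' : IsModel (termConstraint γB R U) φ' f')
          (hn : ∀ t : U, (f t none)ᶜ = (f' t none)ᶜ) :
          f ⟨.sup s hs t, ht⟩ (some i) ≤ f' ⟨.sup s hs t, ht⟩ (some i) := by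
        refine (h'.isPartition ⟨.sup s hs t, ht⟩).le fun v => ?_
        cases v with
        | none =>
          refine le_trans (le_of_eq ?_) bot_le
          rw [← compl_injective (hn ⟨.sup s hs t, ht⟩)]
          exact (h.isPartition _).disjoint _ _ (Option.some_ne_none i)
        | some j =>
          rcases trichotomous_of WellOrderingRel i.1 j.1 with hij | hij | hij
          · rw [inf_comm, hdisj h' h (fun t => (hn t).symm) s hs t ht j i hij]
            exact bot_le
          · obtain rfl := Subtype.ext hij
            exact inf_le_right
          · rw [hdisj h h' hn s hs t ht i j hij]
            exact bot_le
      exact le_antisymm (hle h h' hnone) (hle h' h fun t => (hnone t).symm)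

/-! ### The canonical model -/

/-- The region where a given witness is the first one for the truth of a term. -/
noncomputable def witnessRegion (A : KBool κ) {G : Type u} (γ : G → A.carrier) :
    (t : Term κ G) → Option t.Witness → A.carrier
  | .gen g, v => v.elim (A.eval γ (.gen g))ᶜ fun _ => A.eval γ (.gen g)
  | .compl t, v => v.elim (A.eval γ (.compl t))ᶜ fun _ => A.eval γ (.compl t)
  | .sup s hs t, v => v.elim (A.eval γ (.sup s hs t))ᶜ fun i => A.eval γ (t i) ⊓
      (A.sup (Set.range fun j : {j : s // WellOrderingRel j.1 i.1} => A.eval γ (t j))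
        (mk_range_le.trans_lt ((mk_subtype_le _).trans_lt hs)))ᶜ

theorem witnessRegion_none (A : KBool κ) {G : Type u} (γ : G → A.carrier) (t : Term κ G) :
    A.witnessRegion γ t none = (A.eval γ t)ᶜ := by
  cases t <;> rfl

theorem witnessRegion_sup_le (A : KBool κ) {G : Type u} (γ : G → A.carrier) (s : Set κ.out)
    (hs : #s < κ) (t : s → Term κ G) (i : s) :
    A.witnessRegion γ (.sup s hs t) (some i) ≤ A.eval γ (t i) :=
  inf_le_left

theorem witnessRegion_sup_inf (A : KBool κ) {G : Type u} (γ : G → A.carrier) (s : Set κ.out)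
    (hs : #s < κ) (t : s → Term κ G) (i j : s) (hij : WellOrderingRel j.1 i.1) :
    A.witnessRegion γ (.sup s hs t) (some i) ⊓ A.eval γ (t j) = ⊥ := by
  rw [← disjoint_iff, ← le_compl_iff_disjoint_right]
  exact inf_le_right.trans (compl_le_compl ((A.isLUB_sup _ _).1 ⟨⟨j, hij⟩, rfl⟩))

theorem witnessRegion_some_le (A : KBool κ) {G : Type u} (γ : G → A.carrier) (t : Term κ G)
    (i : t.Witness) : A.witnessRegion γ t (some i) ≤ A.eval γ t := by
  cases t with
  | gen g => exact le_rfl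
  | compl t => exact le_rfl
  | sup s hs t =>
    exact (A.witnessRegion_sup_le γ s hs t i).trans ((A.isLUB_eval_sup γ s hs t).1 ⟨i, rfl⟩)

/-- For a join this is the usual disjointification along a well-order: each member minus the join of
the earlier ones. -/
theorem isPartition_witnessRegion (A : KBool κ) {G : Type u} (γ : G → A.carrier)
    (t : Term κ G) : IsPartition (A.witnessRegion γ t) := by
  cases t with
  | gen g => exact isPartition_pair fun i => (compl_compl _).symm
  | compl t => exact isPartition_pair fun i => (compl_compl _).symm
  | sup s hs t =>
    have hnone (i : s) : A.witnessRegion γ (.sup s hs t) (some i) ⊓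
        A.witnessRegion γ (.sup s hs t) none = ⊥ := by
      rw [witnessRegion_none, ← disjoint_iff, ← le_compl_iff_disjoint_right, compl_compl]
      exact A.witnessRegion_some_le γ (.sup s hs t) i
    have hlt (i j : s) (hij : WellOrderingRel j.1 i.1) :
        A.witnessRegion γ (.sup s hs t) (some i) ⊓
          A.witnessRegion γ (.sup s hs t) (some j) = ⊥ := by
      rw [eq_bot_iff, ← A.witnessRegion_sup_inf γ s hs t i j hij]
      exact inf_le_inf_left _ (A.witnessRegion_sup_le γ s hs t j)
    refine ⟨?_, fun _ _ => le_top, fun y hy => ?_⟩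
    · rintro (_ | i) (_ | j) hij
      · exact absurd rfl hij
      · rw [inf_comm]
        exact hnone j
      · exact hnone i
      · rcases trichotomous_of WellOrderingRel i.1 j.1 with h | h | h
        · rw [inf_comm]
          exact hlt j i h
        · exact absurd (congrArg some (Subtype.ext h)) hij
        · exact hlt i j h
    · have key : ∀ i : s, A.eval γ (t i) ≤ y := by
        intro i
        have wf := InvImage.wf (fun i : s => i.1) (WellOrderingRel.isWellOrder (α := κ.out)).wf
        induction i using wf.induction with
        | _ i ih =>
          have h1 : A.sup (Set.range fun j : {j : s // WellOrderingRel j.1 i.1} =>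
              A.eval γ (t j)) (mk_range_le.trans_lt ((mk_subtype_le _).trans_lt hs)) ≤ y := by
            refine (A.isLUB_sup _ _).2 ?_
            rintro _ ⟨j, rfl⟩
            exact ih j.1 j.2
          have h2 : A.witnessRegion γ (.sup s hs t) (some i) ≤ y := hy ⟨some i, rfl⟩
          change _ ⊓ (_)ᶜ ≤ y at h2
          rw [← sdiff_eq, sdiff_le_iff, sup_eq_right.2 h1] at h2
          exact h2
      have h1 : A.eval γ (.sup s hs t) ≤ y := by
        refine (A.isLUB_eval_sup γ s hs t).2 ?_
        rintro _ ⟨i, rfl⟩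
        exact key i
      have h2 : (A.eval γ (.sup s hs t))ᶜ ≤ y := by
        rw [← witnessRegion_none]
        exact hy ⟨none, rfl⟩
      rw [← sup_compl_eq_top (x := A.eval γ (.sup s hs t))]
      exact sup_le h1 h2

/-- Each way in which compatibility can fail places the two regions below complementary elements, or
pairs a first witness with an earlier true member. -/
theorem witnessRegion_inf_eq_bot (A : KBool κ) {G : Type u} (γ : G → A.carrier)
    {R : Set (Term κ G × Term κ G)} (hR : ∀ r ∈ R, A.eval γ r.1 = A.eval γ r.2) {t t' : Term κ G}
    {v : Option t.Witness} {v' : Option t'.Witness} (h : ¬ Term.Compat R t t' v v') :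
    A.witnessRegion γ t v ⊓ A.witnessRegion γ t' v' = ⊥ := by
  have hle {t : Term κ G} {v : Option t.Witness} (hv : v ≠ none) :
      A.witnessRegion γ t v ≤ A.eval γ t := by
    obtain ⟨i, rfl⟩ := Option.ne_none_iff_exists'.1 hv
    exact A.witnessRegion_some_le γ t i
  have hle' {t : Term κ G} {v : Option t.Witness} (hv : v = none) :
      A.witnessRegion γ t v ≤ (A.eval γ t)ᶜ := by
    rw [hv, witnessRegion_none]
  by_contra hne
  have hbot {x y a : A.carrier} (hx : x ≤ a) (hy : y ≤ aᶜ) : x ⊓ y = ⊥ :=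
    le_bot_iff.1 ((inf_le_inf hx hy).trans_eq inf_compl_eq_bot)
  refine h ⟨?_, fun hr => ?_, ?_⟩
  · rintro rfl
    by_cases hv : v = none <;> by_cases hv' : v' = none
    · refine absurd (hbot (hle' hv) ?_) hne
      rw [eval, compl_compl]
      exact hle' hv'
    · exact iff_of_true hv hv'
    · exact iff_of_false hv fun h => h hv'
    · refine absurd ?_ hne
      rw [inf_comm]
      exact hbot (hle hv') (hle hv)
  · have h12 := hR _ hr
    dsimp only at h12
    by_cases hv : v = none <;> by_cases hv' : v' = none
    · exact iff_of_true hv hv'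
    · refine absurd ?_ hne
      rw [inf_comm]
      exact hbot ((hle hv').trans_eq h12.symm) (hle' hv)
    · exact absurd (hbot ((hle hv).trans_eq h12) (hle' hv')) hne
    · exact iff_of_false hv hv'
  · cases t with
    | gen g => trivial
    | compl t => trivial
    | sup s hs t =>
      rintro j rfl
      refine ⟨?_, ?_⟩
      · rintro rfl
        by_contra hv'
        refine hne ?_
        rw [inf_comm]
        refine hbot ((hle hv').trans ((A.isLUB_eval_sup γ s hs t).1 ⟨j, rfl⟩)) ?_
        exact hle' rfl
      · rintro i rfl
        refine ⟨?_, fun hij => ?_⟩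
        · rintro rfl hv'
          exact hne (hbot (A.witnessRegion_sup_le γ s hs t j) (hle' hv'))
        · by_contra hv'
          refine hne (le_bot_iff.1 ?_)
          rw [← A.witnessRegion_sup_inf γ s hs t i j hij]
          exact inf_le_inf_left _ (hle hv')

theorem isModel_witnessRegion {A : KBool κ} {γ : G ⊕ J → A.carrier} (f : Hom B A)
    (hγ : ∀ j, γ (.inr j) = f (γB j)) (hR : ∀ r ∈ R, A.eval γ r.1 = A.eval γ r.2) :
    IsModel (termConstraint γB R U) f fun t => A.witnessRegion γ t.1 where
  isPartition t := A.isPartition_witnessRegion γ t.1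
  le t t' v v' := by
    rw [termConstraint]
    split_ifs with h
    · refine inf_le_left.trans ?_
      obtain ⟨t, ht⟩ := t
      dsimp only
      rcases t with (g | j) | t | ⟨s, hs, t⟩
      · exact le_top.trans_eq (map_top f.toLatticeHom).symm
      · rw [Term.baseRegion]
        split_ifs with hv
        · rw [hv, witnessRegion_none, eval, hγ, f.map_compl]
        · obtain ⟨i, rfl⟩ := Option.ne_none_iff_exists'.1 hv
          exact (A.witnessRegion_some_le γ _ i).trans_eq (hγ j)
      · exact le_top.trans_eq (map_top f.toLatticeHom).symm
      · exact le_top.trans_eq (map_top f.toLatticeHom).symm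
    · rw [A.witnessRegion_inf_eq_bot γ hR h]
      exact bot_le

end TermSystem

/-- A presentation of an algebra over `B` whose generators include those of `B`. -/
theorem IsPresentation.adjoin (hκ : ℵ₀ ≤ κ) {A B : KBool κ} {G J : Type u}
    {R : Set (Term κ G × Term κ G)} {γ : G → A.carrier} (h : A.IsPresentation R γ)
    (hR : #R < κ) (hJ : #J < κ) (f : Hom B A) (γB : J → B.carrier) :
    ∃ R' : Set (Term κ (G ⊕ J) × Term κ (G ⊕ J)), #R' < κ ∧
      A.IsPresentation R' (Sum.elim γ fun j => f (γB j)) := by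
  -- The new generators are redundant: each is equated with a term in the old ones that already has
  -- its value.
  choose τ hτ using fun j => h.eval_surjective hκ (f (γB j))
  refine ⟨(fun r => (r.1.map Sum.inl, r.2.map Sum.inl)) '' R ∪
    Set.range fun j => (.gen (.inr j), (τ j).map Sum.inl), ?_, ?_, ?_⟩
  · exact (mk_union_le _ _).trans_lt
      (add_lt_of_lt hκ (mk_image_le.trans_lt hR) (mk_range_le.trans_lt hJ))
  · rintro _ (⟨r, hr, rfl⟩ | ⟨j, rfl⟩)
    · simp only [eval_map]
      exact h.1 r hr
    · simp only [eval_map]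
      exact (hτ j).symm
  · intro C δ hδ
    obtain ⟨φ, hφ, -⟩ := h.2 C (fun g => δ (.inl g)) fun r hr => by
      have := hδ _ (Or.inl ⟨r, hr, rfl⟩)
      rwa [eval_map, eval_map] at this
    refine ⟨φ, ?_, fun ψ hψ => h.hom_ext fun g => (hψ (.inl g)).trans (hφ g).symm⟩
    rintro (g | j)
    · exact hφ g
    · have := hδ _ (Or.inr ⟨j, rfl⟩)
      rw [eval_map] at this
      change φ (f (γB j)) = _
      rw [← hτ j, φ.map_eval]
      simp only [hφ]
      exact this.symm

/-- Every homomorphism between `κ`-presented algebras is dual to a codirected limit of fiberwise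
`κ`-ary locales. -/
theorem isCodirectedLimit_of_isKPresented (hκ : κ.IsRegular) {A B : KBool κ}
    (hA : A.IsKPresented) (hB : B.IsKPresented) (f : Hom B A) :
    IsCodirectedLimitOfFiberwiseKary (Quiver.Hom.op (f : B ⟶ A)) := by
  have hκ' := hκ.aleph0_le
  obtain ⟨G, R₀, γ₀, hG, hR₀, hA⟩ := hA
  obtain ⟨J, RB, γB, hJ, hRB, hB'⟩ := id hB
  obtain ⟨R, hR, hA'⟩ := hA.adjoin hκ' hR₀ hJ f γB
  obtain ⟨U, hUsub, hUκ, hU⟩ := exists_subtermClosed hκ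
    (Set.range (Term.gen (κ := κ) (G := G ⊕ J)) ∪ (Prod.fst '' R ∪ Prod.snd '' R)) (by
      refine (mk_union_le _ _).trans_lt (add_lt_of_lt hκ' (mk_range_le.trans_lt ?_)
        ((mk_union_le _ _).trans_lt (add_lt_of_lt hκ' (mk_image_le.trans_lt hR)
          (mk_image_le.trans_lt hR))))
      rw [mk_sum, lift_id, lift_id]
      exact add_lt_of_lt hκ' hG hJ)
  have hgen : ∀ g, .gen g ∈ U := fun g => hUsub (Or.inl ⟨g, rfl⟩)
  have hRU : ∀ r ∈ R, r.1 ∈ U ∧ r.2 ∈ U := fun r hr =>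
    ⟨hUsub (Or.inr (Or.inl ⟨r, hr, rfl⟩)), hUsub (Or.inr (Or.inr ⟨r, hr, rfl⟩))⟩
  have hmodel := isModel_witnessRegion (γB := γB) (U := U) f (fun j => rfl) hA'.1
  refine isCodirectedLimit_of_isModel hκ hB hUκ (fun t => t.1.mk_option_witness_lt hκ')
    (termConstraint γB R U) f _ hmodel ?_ ?_
  · intro C φ e' h
    obtain ⟨θ, hθ, -⟩ := hA'.2 C _ (h.eval_rel hU hgen hRU)
    refine ⟨θ, fun y => ?_, fun t v => ?_⟩
    · have : f.comp θ = φ := hB'.hom_ext fun j => (hθ (.inr j)).trans (h.gen_inr hgen j)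
      exact congrArg (fun g : Hom B C => g y) this
    -- The image under `θ` of the universal model and the given model have the same generators,
    -- hence coincide.
    · refine (hmodel.map hκ' θ).unique hU hgen h (fun g => ?_) t v
      rw [witnessRegion_none, θ.map_compl, compl_compl]
      exact hθ g
  · intro C θ θ' h
    refine hA'.hom_ext fun g => ?_
    have := h ⟨.gen g, hgen g⟩ none
    rw [witnessRegion_none, θ.map_compl, θ'.map_compl] at this
    exact compl_injective this

/-! ### Strong amalgamation -/

theorem mem_lowerSet_compl {P : Type u} [Preorder P] {U : LowerSet P} {p : P} :
    p ∈ Uᶜ ↔ ∀ q ≤ p, q ∉ U := by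
  rw [← LowerSet.Iic_le, le_compl_iff_disjoint_right, disjoint_iff, eq_bot_iff]
  exact ⟨fun h q hq hqU => h ⟨hq, hqU⟩, fun h q hq => h q hq.1 hq.2⟩

/-- The complete Boolean algebra of regular lower sets of the complement of a lower set. -/
def regular (κ : Cardinal.{u}) {M : Type u} [PartialOrder M] (D : Set M) : KBool κ where
  carrier := Heyting.Regular (LowerSet {m : M // m ∉ D})
  exists_isLUB _ _ := ⟨_, Heyting.Regular.gi.isLUB_of_u_image (isLUB_sSup _)⟩

/-- A forcing construction: elements of `M` are conditions, `D` holds the null ones, and `act a m`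
is the part of `m` inside `a`. The element `a` goes to the conditions that force it, those whose
part inside `aᶜ` is null. A non-null condition has a non-null part inside `a` or `aᶜ`, which gives
complements and regularity. -/
theorem exists_hom_regular (hκ : ℵ₀ ≤ κ) (A : KBool κ) {M : Type u} [PartialOrder M] (D : Set M)
    (hD : IsLowerSet D) (act : A.carrier → M → M) (act_le : ∀ a m, act a m ≤ m)
    (act_mono : ∀ a, Monotone (act a)) (act_top : ∀ m, act ⊤ m = m)
    (act_act : ∀ a b m, act a (act b m) = act (a ⊓ b) m)
    (act_lub : ∀ (s : Set A.carrier) (a : A.carrier) (m : M), #s < κ → IsLUB s a →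
      (∀ x ∈ s, act x m ∈ D) → act a m ∈ D) :
    ∃ h : Hom A (regular κ D), ∀ a (p : {m : M // m ∉ D}),
      p ∈ (Heyting.Regular.val (h a) : LowerSet _) ↔ act aᶜ p.1 ∈ D := by
  have hsplit (a : A.carrier) (m : M) (h1 : act a m ∈ D) (h2 : act aᶜ m ∈ D) : m ∈ D := by
    rw [← act_top m]
    refine act_lub {a, aᶜ} ⊤ m ((lt_aleph0_iff_set_finite.2 (Set.toFinite _)).trans_le hκ) ?_ ?_
    · rw [← sup_compl_eq_top (x := a)]
      exact isLUB_pair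
    · rintro x (rfl | rfl)
      exacts [h1, h2]
  have hbot (m : M) : act ⊥ m ∈ D :=
    act_lub ∅ ⊥ m (by simpa using aleph0_pos.trans_le hκ) (by simp) (by simp)
  let f (a : A.carrier) : LowerSet {m : M // m ∉ D} :=
    ⟨{p | act aᶜ p.1 ∈ D}, fun p q hqp hp => hD (act_mono _ hqp) hp⟩
  have hf (a : A.carrier) (p : {m : M // m ∉ D}) : p ∈ f a ↔ act aᶜ p.1 ∈ D := Iff.rfl
  have hcompl (a : A.carrier) : f aᶜ = (f a)ᶜ := by
    refine LowerSet.ext (Set.ext fun p => ?_)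
    change p ∈ f aᶜ ↔ p ∈ (f a)ᶜ
    rw [hf, mem_lowerSet_compl, compl_compl]
    refine ⟨fun h q hq hqa => q.2 (hsplit a q.1 (hD (act_mono a hq) h) hqa), fun h => ?_⟩
    by_contra hp
    refine h ⟨act a p.1, hp⟩ (act_le a p.1) ?_
    rw [hf, act_act, compl_inf_eq_bot]
    exact hbot _
  have hreg (a : A.carrier) : Heyting.IsRegular (f a) := by
    rw [Heyting.IsRegular, ← hcompl, ← hcompl, compl_compl]
  have hmono {a b : A.carrier} (hab : a ≤ b) : f a ≤ f b := by
    intro p hp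
    change act bᶜ p.1 ∈ D
    have : act bᶜ p.1 = act bᶜ (act aᶜ p.1) := by
      rw [act_act, inf_eq_left.2 (compl_le_compl hab)]
    rw [this]
    exact hD (act_le _ _) hp
  refine ⟨.ofCompl hκ (fun a => (⟨f a, hreg a⟩ : Heyting.Regular _)) (fun a => ?_) ?_,
    fun a p => hf a p⟩
  · exact Heyting.Regular.coe_injective (hcompl a)
  · intro s hs a ha
    constructor
    · rintro _ ⟨x, hx, rfl⟩
      exact hmono (ha.1 hx)
    · intro V hV
      change f a ≤ V.val
      rw [← V.prop.eq]
      intro p hp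
      change p ∈ (V.valᶜ)ᶜ
      rw [mem_lowerSet_compl]
      intro q hq hqV
      have hqa : act aᶜ q.1 ∈ D := (f a).lower hq hp
      -- If `q` forces `a` but misses `V` hereditarily, then its part inside every `x ∈ s` is null,
      -- since a non-null one would lie in `V`; so its part inside `a` is null too, and `q` is null.
      refine q.2 (hsplit a q.1 (act_lub s a q.1 hs ha fun x hx => ?_) hqa)
      by_contra hxq
      have h1 : (⟨act x q.1, hxq⟩ : {m : M // m ∉ D}) ∈ f x := by
        rw [hf, act_act, compl_inf_eq_bot]
        exact hbot _
      exact mem_lowerSet_compl.1 hqV _ (act_le x q.1) (hV ⟨x, hx, rfl⟩ h1)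

/-- Elements outside the image of a homomorphism are separated by two homomorphisms that agree on
the image. -/
theorem exists_separation (hκ : ℵ₀ ≤ κ) {C A : KBool κ} (τ : Hom C A) (a : A.carrier)
    (ha : a ∉ Set.range τ) :
    ∃ (K : KBool κ) (α β : Hom A K), (∀ c, α (τ c) = β (τ c)) ∧ α a ≠ β a := by
  -- A pair stands for a rectangle in the pushout of two copies of `A` over `C`; it is empty when
  -- some `c` in `C` separates its sides. The maps `α` and `β` come from restricting the first and
  -- the second side.
  let D : Set (A.carrier × A.carrier) := {m | ∃ c, m.1 ≤ τ c ∧ m.2 ≤ (τ c)ᶜ}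
  have hD : IsLowerSet D := by
    rintro m n hnm ⟨c, h1, h2⟩
    exact ⟨c, hnm.1.trans h1, hnm.2.trans h2⟩
  obtain ⟨α, hα⟩ := exists_hom_regular hκ A D hD (fun a m => (a ⊓ m.1, m.2))
    (fun a m => ⟨inf_le_right, le_rfl⟩) (fun a m n h => ⟨inf_le_inf_left _ h.1, h.2⟩)
    (fun m => by simp) (fun a b m => by simp [inf_assoc]) (by
      intro s a m hs ha h
      choose! r hr using h
      -- The separating element is the join of those for the members of `s`; for `β` below it is
      -- their meet.
      obtain ⟨c, hc⟩ := C.exists_isLUB (r '' s) (mk_image_le.trans_lt hs)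
      have hc' := τ.map_isLUB _ (mk_image_le.trans_lt hs) c hc
      refine ⟨c, ?_, ?_⟩
      · dsimp only
        rw [← le_himp_iff]
        refine ha.2 fun x hx => ?_
        rw [le_himp_iff]
        exact (hr x hx).1.trans (hc'.1 ⟨_, ⟨x, hx, rfl⟩, rfl⟩)
      · dsimp only
        rw [le_compl_comm]
        refine hc'.2 ?_
        rintro _ ⟨_, ⟨x, hx, rfl⟩, rfl⟩
        exact le_compl_comm.1 (hr x hx).2)
  obtain ⟨β, hβ⟩ := exists_hom_regular hκ A D hD (fun a m => (m.1, a ⊓ m.2))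
    (fun a m => ⟨le_rfl, inf_le_right⟩) (fun a m n h => ⟨h.1, inf_le_inf_left _ h.2⟩)
    (fun m => by simp) (fun a b m => by simp [inf_assoc]) (by
      intro s a m hs ha h
      choose! r hr using h
      obtain ⟨c, hc⟩ := C.exists_isLUB ((fun x => (r x)ᶜ) '' s) (mk_image_le.trans_lt hs)
      have hc' := τ.map_isLUB _ (mk_image_le.trans_lt hs) c hc
      refine ⟨cᶜ, ?_, ?_⟩
      · dsimp only
        rw [τ.map_compl, le_compl_comm]
        refine hc'.2 ?_
        rintro _ ⟨_, ⟨x, hx, rfl⟩, rfl⟩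
        rw [τ.map_compl]
        exact compl_le_compl (hr x hx).1
      · dsimp only
        rw [τ.map_compl, compl_compl, ← le_himp_iff]
        refine ha.2 fun x hx => ?_
        rw [le_himp_iff]
        refine (hr x hx).2.trans ?_
        rw [← τ.map_compl]
        exact hc'.1 ⟨_, ⟨x, hx, rfl⟩, rfl⟩)
  refine ⟨regular κ D, α, β, fun c => ?_, fun h => ha ?_⟩
  · refine Heyting.Regular.coe_injective (LowerSet.ext (Set.ext fun p => ?_))
    refine (hα (τ c) p).trans (Iff.trans ?_ (hβ (τ c) p).symm)
    constructor
    · rintro ⟨d, h1, h2⟩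
      refine ⟨c ⊔ d, ?_, ?_⟩
      · rw [map_sup τ.toLatticeHom]
        dsimp only at h1 ⊢
        rwa [inf_comm, ← sdiff_eq, sdiff_le_iff] at h1
      · rw [map_sup τ.toLatticeHom, compl_sup]
        exact inf_le_inf_left _ h2
    · rintro ⟨d, h1, h2⟩
      refine ⟨d ⊓ cᶜ, ?_, ?_⟩
      · rw [map_inf τ.toLatticeHom, τ.map_compl, inf_comm]
        exact inf_le_inf_right _ h1
      · rw [map_inf τ.toLatticeHom, τ.map_compl, compl_inf, compl_compl, sup_comm]
        dsimp only at h2 ⊢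
        rwa [inf_comm, ← sdiff_eq, sdiff_le_iff] at h2
  -- `(a, aᶜ)` forces `α a` trivially, and it forces `β a` only if it is null. An element separating
  -- `a` from `aᶜ` must have image `a`.
  · have hp : ((a, aᶜ) : A.carrier × A.carrier) ∈ D := by
      by_contra hp
      have h1 : (⟨(a, aᶜ), hp⟩ : {m // m ∉ D}) ∈ (Heyting.Regular.val (α a) : LowerSet _) := by
        refine (hα a _).2 ⟨⊥, ?_, ?_⟩
        · dsimp only
          rw [compl_inf_eq_bot]
          exact bot_le
        · rw [map_bot τ.toLatticeHom, compl_bot]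
          exact le_top
      rw [h] at h1
      have := (hβ a _).1 h1
      dsimp only at this
      rw [inf_idem] at this
      exact hp this
    obtain ⟨c, h1, h2⟩ := hp
    exact ⟨c, le_antisymm (compl_le_compl_iff_le.1 h2) h1⟩

/-! ### Presented algebras -/

/-- A coordinate projection of a product. -/
def piEval (hκ : ℵ₀ ≤ κ) {S : Type u} (B : S → KBool κ) (s : S) : Hom (pi B) (B s) :=
  .ofCompl hκ (fun x => x s) (fun _ => rfl) fun _ _ _ h => isLUB_pi.1 h s

/-- `A` is the quotient of the terms by equality of values, so it maps to any algebra in which those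
equalities hold. -/
theorem exists_hom_of_eval (hκ : ℵ₀ ≤ κ) {A C : KBool κ} {G : Type u} {γ : G → A.carrier}
    (hγ : Function.Surjective (A.eval γ)) (δ : G → C.carrier)
    (h : ∀ t t', A.eval γ t = A.eval γ t' → C.eval δ t = C.eval δ t') :
    ∃ θ : Hom A C, ∀ t, θ (A.eval γ t) = C.eval δ t := by
  obtain ⟨r, hr⟩ := hγ.hasRightInverse
  refine ⟨.ofCompl hκ (fun z => C.eval δ (r z)) (fun z => ?_) ?_, fun t => h _ _ (hr _)⟩
  · refine h _ (.compl (r z)) ?_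
    rw [hr, eval, hr]
  · intro s hs a ha
    have h1 := A.isLUB_eval_iSup γ hs fun x => r x
    have h2 := C.isLUB_eval_iSup δ hs fun x => r x
    simp only [hr _, Subtype.range_coe] at h1
    have : C.eval δ (r a) = C.eval δ (Term.iSup hs fun x => r x) :=
      h _ _ (by rw [hr, ha.unique h1])
    rw [this, Set.image_eq_range]
    exact h2

/-- Every set of relations presents an algebra. -/
theorem exists_isPresentation (hκ : ℵ₀ ≤ κ) {G : Type u} (R : Set (Term κ G × Term κ G)) :
    ∃ (A : KBool κ) (γ : G → A.carrier), A.IsPresentation R γ := by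
  -- Algebras satisfying `R` form a large collection, but the equivalence relations they induce on
  -- terms form a small one; one representative of each suffices for the product.
  let I := {r : Term κ G → Term κ G → Prop // ∃ (B : KBool κ) (δ : G → B.carrier),
    (∀ p ∈ R, B.eval δ p.1 = B.eval δ p.2) ∧ ∀ t t', r t t' ↔ B.eval δ t = B.eval δ t'}
  choose B δ hδ hr using fun i : I => i.2
  let ε : G → (pi B).carrier := fun g i => δ i g
  have hε (i : I) (t : Term κ G) : (pi B).eval ε t i = (B i).eval (δ i) t :=
    (piEval hκ B i).map_eval ε t
  let A := (pi B).sub hκ (Set.range ((pi B).eval ε)) ((pi B).eval_range_compl ε)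
    ((pi B).eval_range_isLUB ε)
  let j : Hom A (pi B) := (pi B).subHom hκ (Set.range ((pi B).eval ε))
    ((pi B).eval_range_compl ε) ((pi B).eval_range_isLUB ε)
  let γ : G → A.carrier := fun g => ⟨ε g, .gen g, rfl⟩
  have hj : ∀ t, (A.eval γ t).1 = (pi B).eval ε t := fun t => j.map_eval γ t
  have hsurj : Function.Surjective (A.eval γ) := by
    rintro ⟨_, t, rfl⟩
    exact ⟨t, Subtype.ext (hj t)⟩
  refine ⟨A, γ, fun p hp => Subtype.ext ?_, fun C η hη => ?_⟩
  · rw [hj, hj]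
    refine funext fun i => ?_
    rw [hε, hε]
    exact hδ i p hp
  · obtain ⟨θ, hθ⟩ := exists_hom_of_eval hκ hsurj η fun t t' htt => by
      let i : I := ⟨fun t t' => C.eval η t = C.eval η t', C, η, hη, fun _ _ => Iff.rfl⟩
      refine (hr i t t').2 ?_
      rw [← hε, ← hε, ← hj, ← hj, htt]
    refine ⟨θ, fun g => hθ (.gen g), fun θ' hθ' => Hom.ext_apply fun x => ?_⟩
    obtain ⟨t, rfl⟩ := hsurj x
    rw [θ'.map_eval, hθ]
    simp only [hθ']

/-- Elements of a `κ`-presented algebra outside the image of a homomorphism from a `κ`-presented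
algebra are separated by homomorphisms to a `κ`-presented algebra. -/
theorem exists_separation_isKPresented (hκ : ℵ₀ ≤ κ) {C A : KBool κ} (hC : C.IsKPresented)
    (hA : A.IsKPresented) (τ : Hom C A) (a : A.carrier) (ha : a ∉ Set.range τ) :
    ∃ (K : KBool κ) (α β : Hom A K), K.IsKPresented ∧ (∀ c, α (τ c) = β (τ c)) ∧ α a ≠ β a := by
  obtain ⟨J, RC, γC, hJ, -, hC⟩ := hC
  obtain ⟨G, R, γ, hG, hR, hA⟩ := hA
  choose σ hσ using fun j => hA.eval_surjective hκ (τ (γC j))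
  -- These relations present the pushout of two copies of `A` over `C`; identifying the images of
  -- the generators of `C` is enough.
  let R' : Set (Term κ (G ⊕ G) × Term κ (G ⊕ G)) :=
    (fun r => (r.1.map Sum.inl, r.2.map Sum.inl)) '' R ∪
    ((fun r => (r.1.map Sum.inr, r.2.map Sum.inr)) '' R ∪
    Set.range fun j => ((σ j).map Sum.inl, (σ j).map Sum.inr))
  have hsat (K : KBool κ) (δ : G ⊕ G → K.carrier) :
      (∀ r ∈ R', K.eval δ r.1 = K.eval δ r.2) ↔
        (∀ r ∈ R, K.eval (fun g => δ (.inl g)) r.1 = K.eval (fun g => δ (.inl g)) r.2) ∧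
        (∀ r ∈ R, K.eval (fun g => δ (.inr g)) r.1 = K.eval (fun g => δ (.inr g)) r.2) ∧
        ∀ j, K.eval (fun g => δ (.inl g)) (σ j) = K.eval (fun g => δ (.inr g)) (σ j) := by
    simp only [R', Set.mem_union, or_imp, forall_and, Set.forall_mem_image, Set.forall_mem_range,
      eval_map]
  obtain ⟨K, ε, hK⟩ := exists_isPresentation hκ R'
  obtain ⟨h1, h2, h3⟩ := (hsat K ε).1 hK.1
  obtain ⟨α, hα, -⟩ := hA.2 K _ h1
  obtain ⟨β, hβ, -⟩ := hA.2 K _ h2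
  refine ⟨K, α, β, ⟨G ⊕ G, R', ε, ?_, ?_, hK⟩, fun c => ?_, fun hab => ?_⟩
  · rw [← add_def]
    exact add_lt_of_lt hκ hG hG
  · exact (mk_union_le _ _).trans_lt (add_lt_of_lt hκ (mk_image_le.trans_lt hR)
      ((mk_union_le _ _).trans_lt (add_lt_of_lt hκ (mk_image_le.trans_lt hR)
        (mk_range_le.trans_lt hJ))))
  · have : τ.comp α = τ.comp β := by
      refine hC.hom_ext fun j => ?_
      change α (τ (γC j)) = β (τ (γC j))
      rw [← hσ, α.map_eval, β.map_eval]
      simp only [hα, hβ]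
      exact h3 j
    exact congrArg (fun f : Hom C K => f c) this
  -- The separating pair need not land in a presented algebra, but it factors through the presented
  -- pushout, which therefore separates `a` too.
  · obtain ⟨K', α', β', h, hne⟩ := exists_separation hκ τ a ha
    obtain ⟨θ, hθ, -⟩ := hK.2 K' (Sum.elim (fun g => α' (γ g)) fun g => β' (γ g)) (by
      rw [hsat]
      simp only [Sum.elim_inl, Sum.elim_inr, ← Hom.map_eval]
      refine ⟨fun r hr => by rw [hA.1 r hr], fun r hr => by rw [hA.1 r hr], fun j => ?_⟩
      rw [hσ, h])
    have e1 : α.comp θ = α' := hA.hom_ext fun g => (congrArg θ (hα g)).trans (hθ (.inl g))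
    have e2 : β.comp θ = β' := hA.hom_ext fun g => (congrArg θ (hβ g)).trans (hθ (.inr g))
    exact hne ((congrArg (fun f : Hom A K' => f a) e1).symm.trans ((congrArg θ hab).trans
      (congrArg (fun f : Hom A K' => f a) e2)))

end KBool

/-! ### Analytic locales -/

/-- An element outside the image would be separated by two maps that `m` equalizes. -/
theorem surjective_of_mono (hκ : ℵ₀ ≤ κ) {X Y : KBorLoc κ} (m : X ⟶ Y) [Mono m] :
    Function.Surjective (KBool.Hom.toLatticeHom m.unop) := by
  intro a
  by_contra ha
  obtain ⟨K, α, β, h, hne⟩ := KBool.exists_separation hκ m.unop a ha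
  have hcomp : Quiver.Hom.op (α : X.unop ⟶ K) ≫ m = Quiver.Hom.op (β : X.unop ⟶ K) ≫ m :=
    Quiver.Hom.unop_inj (KBool.Hom.ext_apply h)
  have := (cancel_mono m).1 hcomp
  exact hne (congrArg (fun f => KBool.Hom.toLatticeHom (Quiver.Hom.unop f) a) this)

/-- The algebraic image of `p.unop` is dual to a subobject of `Q` through which `p` factors. The
least such subobject lies inside it, so elements identified by `e` are already equal. -/
theorem IsAnalytic.exists_cover (hκ : ℵ₀ ≤ κ) {X : KBorLoc κ} (hX : IsAnalytic X) :
    ∃ (P : KBorLoc κ) (e : P ⟶ X), IsStandard P ∧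
      Function.Injective (KBool.Hom.toLatticeHom e.unop) := by
  obtain ⟨P, Q, p, m, hm, hP, hQ, hfac, hleast⟩ := hX
  obtain ⟨e, he⟩ : ∃ e : P ⟶ X, e ≫ m = p := (Subobject.mk_factors_iff _ _).1 hfac
  refine ⟨P, e, hP, ?_⟩
  obtain ⟨M, q, j, hq, hj, hqj⟩ := KBool.Hom.exists_image hκ p.unop
  have : Mono (Quiver.Hom.op (X := Q.unop) (Y := M) q) := mono_op_of_surjective (q : Q.unop ⟶ M) hq
  have hle : Subobject.mk m ≤ Subobject.mk (Quiver.Hom.op (q : Q.unop ⟶ M)) :=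
    hleast ((Subobject.mk_factors_iff _ _).2
      ⟨Quiver.Hom.op (j : M ⟶ P.unop), Quiver.Hom.unop_inj (KBool.Hom.ext_apply hqj)⟩)
  have hk := Subobject.ofMkLEMk_comp hle
  set k := Subobject.ofMkLEMk _ _ hle
  have hk' (y : Q.unop.carrier) : KBool.Hom.toLatticeHom k.unop (q y) =
      KBool.Hom.toLatticeHom m.unop y :=
    congrArg (fun f => KBool.Hom.toLatticeHom (Quiver.Hom.unop f) y) hk
  have he' (y : Q.unop.carrier) : KBool.Hom.toLatticeHom e.unop
      (KBool.Hom.toLatticeHom m.unop y) = KBool.Hom.toLatticeHom p.unop y :=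
    congrArg (fun f => KBool.Hom.toLatticeHom (Quiver.Hom.unop f) y) he
  intro x x' hxx
  obtain ⟨y, rfl⟩ := surjective_of_mono hκ m x
  obtain ⟨y', rfl⟩ := surjective_of_mono hκ m x'
  rw [he', he', ← hqj, ← hqj] at hxx
  rw [← hk', ← hk', hj hxx]

/-- A monomorphism of analytic locales with standard codomain is dual to a surjection. -/
theorem surjective_of_mono_analytic (hκ : ℵ₀ ≤ κ) {Y : KBorLoc κ} (hY : IsStandard Y)
    {S : KAnLoc κ} (σ : S ⟶ KAnLoc.ofStandard Y hY) [Mono σ] :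
    Function.Surjective (KBool.Hom.toLatticeHom σ.hom.unop) := by
  intro x
  by_contra hx
  -- `S` need not be standard, so the separation takes place on a standard cover; injectivity keeps
  -- the image of `x` outside the range.
  obtain ⟨P, e, hP, he⟩ := S.property.exists_cover hκ
  have hex : KBool.Hom.toLatticeHom e.unop x ∉
      Set.range (KBool.Hom.toLatticeHom (e ≫ σ.hom).unop) := by
    rintro ⟨y, hy⟩
    exact hx ⟨y, he hy⟩
  obtain ⟨K, α, β, hK, h, hne⟩ := KBool.exists_separation_isKPresented hκ hY hP
    (e ≫ σ.hom).unop _ hex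
  have hK' : IsStandard (Opposite.op K) := hK
  let α' : KAnLoc.ofStandard _ hK' ⟶ S :=
    ObjectProperty.homMk (Quiver.Hom.op (α : P.unop ⟶ K) ≫ e)
  let β' : KAnLoc.ofStandard _ hK' ⟶ S :=
    ObjectProperty.homMk (Quiver.Hom.op (β : P.unop ⟶ K) ≫ e)
  have hcomp : α' ≫ σ = β' ≫ σ :=
    ObjectProperty.hom_ext _ (Quiver.Hom.unop_inj (KBool.Hom.ext_apply h))
  have := (cancel_mono σ).1 hcomp
  exact hne (congrArg (fun f : KAnLoc.ofStandard _ hK' ⟶ S =>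
    KBool.Hom.toLatticeHom (Quiver.Hom.unop f.hom) x) this)

/-- Every analytic set is the analytic image of a map from a standard locale. -/
theorem exists_isKAnalyticImage (hκ : ℵ₀ ≤ κ) {Y : KBorLoc κ} (hY : IsStandard Y)
    (A : KAnalyticSet Y hY) :
    ∃ (L : KBorLoc κ) (hL : IsStandard L) (g : L ⟶ Y), IsKAnalyticImage hL hY A g := by
  obtain ⟨P, e, hP, he⟩ := (A : KAnLoc κ).property.exists_cover hκ
  let e' : KAnLoc.ofStandard P hP ⟶ (A : KAnLoc κ) := ObjectProperty.homMk e
  refine ⟨P, hP, e ≫ A.arrow.hom, A.factors_comp_arrow e', fun S hS => ?_⟩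
  let g : KAnLoc.ofStandard P hP ⟶ KAnLoc.ofStandard Y hY :=
    ObjectProperty.homMk (e ≫ A.arrow.hom)
  have hfac : S.factorThru g hS ≫ S.arrow = g := S.factorThru_arrow g hS
  have hfac' (y : Y.unop.carrier) : KBool.Hom.toLatticeHom (S.factorThru g hS).hom.unop
      (KBool.Hom.toLatticeHom S.arrow.hom.unop y) = KBool.Hom.toLatticeHom e.unop
      (KBool.Hom.toLatticeHom A.arrow.hom.unop y) :=
    congrArg (fun f : KAnLoc.ofStandard P hP ⟶ KAnLoc.ofStandard Y hY =>
      KBool.Hom.toLatticeHom (Quiver.Hom.unop f.hom) y) hfac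
  -- Borel sets of `Y` that agree on `S` agree on `P`, hence on `A` because `e` is injective on
  -- Borel sets; so restriction to `A` factors through restriction to `S`.
  obtain ⟨θ, hθ⟩ := KBool.Hom.exists_factor hκ S.arrow.hom.unop
    (surjective_of_mono_analytic hκ hY S.arrow) A.arrow.hom.unop fun y y' h => he
      ((hfac' y).symm.trans ((congrArg _ h).trans (hfac' y')))
  refine Subobject.le_of_comm (ObjectProperty.homMk (Quiver.Hom.op θ)) ?_
  exact ObjectProperty.hom_ext _ (Quiver.Hom.unop_inj (KBool.Hom.ext_apply hθ))

end KappaBorel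

/-- Let `κ` be an infinite regular cardinal and `Y` a standard `κ`-Borel locale. Every `κ`-Borel
map from a standard `κ`-Borel locale to `Y` is, over `Y`, the limit of a `κ`-ary codirected
diagram of standard `κ`-Borel locales that are fiberwise `κ`-ary over `Y`; and every
`κ`-analytic set of `Y` is the `κ`-analytic image of such a limit. -/
theorem mainTheorem6 {κ : Cardinal.{u}} (hκ : κ.IsRegular) (Y : KappaBorel.KBorLoc κ)
    (hY : KappaBorel.IsStandard Y) :
    (∀ (X : KappaBorel.KBorLoc κ), KappaBorel.IsStandard X → ∀ f : X ⟶ Y,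
      KappaBorel.IsCodirectedLimitOfFiberwiseKary f) ∧
    ∀ A : KappaBorel.KAnalyticSet Y hY,
      ∃ (L : KappaBorel.KBorLoc κ) (hL : KappaBorel.IsStandard L) (g : L ⟶ Y),
        KappaBorel.IsCodirectedLimitOfFiberwiseKary g ∧
        KappaBorel.IsKAnalyticImage hL hY A g := by
  have h1 : ∀ (X : KappaBorel.KBorLoc κ), KappaBorel.IsStandard X → ∀ f : X ⟶ Y,
      KappaBorel.IsCodirectedLimitOfFiberwiseKary f :=
    fun X hX f => KappaBorel.KBool.isCodirectedLimit_of_isKPresented hκ hX hY f.unop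
  refine ⟨h1, fun A => ?_⟩
  obtain ⟨L, hL, g, hg⟩ := KappaBorel.exists_isKAnalyticImage hκ.aleph0_le hY A
  exact ⟨L, hL, g, h1 L hL g, hg⟩
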